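/- **Setting.** A represented space is a set $X$ with a partial surjection $\delta_X:\subseteq\mathbb N^{\mathbb N}\to X$; products and coproducts carry the representations $\delta_{X\times Y}\langle p,q\rangle=(\delta_X(p),\delta_Y(q))$, $\delta_{X\sqcup Y}(0p)=(0,\delta_X(p))$, $\delta_{X\sqcup Y}(1p)=(1,\delta_Y(p))$. For multi-valued $f:\subseteq X\rightrightarrows Y$, $g:\subseteq U\rightrightarrows V$ on represented spaces, $\operatorname{dom}(f)=\{x: f(x)\neq\emptyset\}$, and a composition $(h\circ f)(x)$ is defined iff $x\in\operatorname{dom} (f)$ and $f(x)\subseteq\operatorname{dom}(h)$, with value $\bigcup_{y\in f(x)}h(y)$. A realizer of $f$ is a partial $F:\subseteq\mathbb N^{\mathbb N}\to\mathbb N^{\mathbb N}$ with $\delta_YF(p)\in f\delta_X(p)$ for all $p\in\operatorname{dom}(f\delta_X)$, and $f\le_W g$ means that there are computable $K,H:\subseteq\mathbb N^{\mathbb N}\to\mathbb N^{\mathbb N}$ such that $K\langle\mathrm{id},GH\rangle$ realizes $f$ for every realizer $G$ of $g$. Weihrauch degrees are the classes of multi-valued functions under $\equiv_W$, together with an additional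 element $\infty$ strictly above all of them; $0$ is the degree of the nowhere defined function. Let $\Phi_p$ ($p\in\mathbb N^{\mathbb N}$) be the partial functions on $\mathbb N^{\mathbb N}$ computed by a universal machine with oracle $p$, and let $\mathcal M(X,Y)$ be the represented space of the multi-valued functions $\delta_Y\circ\Phi_p\circ(\delta_X^{\rm cyl})^{-1}$, named by $p$, where $\delta_X^{\rm cyl}\langle p,q\rangle=\delta_X(p)$. Put - $f\sqcup g:\subseteq X\sqcup U\rightrightarrows Y\sqcup V$, $(0,x)\mapsto\{0\}\times f(x)$, $(1,u)\mapsto\{1\}\times g(u)$; - $f\times g:\subseteq X\times U\rightrightarrows Y\times V$, $(x,u)\mapsto f(x)\times g(u)$; - $f\sqcap g:\subseteq X\times U\rightrightarrows Y\sqcup V$ with domain $\operatorname{dom}(f)\times\operatorname{dom}(g)$, $(x,u)\mapsto\{0\}\times f(x)\cup\{1\}\times g(u)$; - $g\star f:\subseteq\mathcal M(Y,\mathbb N^{\mathbb N}\times U)\times X\rightrightarrows\mathbb N^{\mathbb N}\times V$, $(h,x)\mapsto((\mathrm{id}\times g)\circ h\circ f)(x)$, i.e. $(\mathrm{id}\times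 g)\circ t$ with $t(h,x)=(h\circ f)(x)$; - $(g\to f):\subseteq X\rightrightarrows\mathcal M(V,Y)\times U$ with domain $\operatorname{dom}(f)$, where $(H,u)\in(g\to f)(x)$ iff $u\in\operatorname{dom}(H\circ g)$ and $(H\circ g)(u)\subseteq f(x)$; this if $\operatorname{dom}(g)\ne\emptyset$ or $\operatorname{dom}(f)=\emptyset$, and otherwise $(g\to f)=\infty$. For the top element, $\mathbf a\sqcup\infty=\mathbf a\times\infty=\mathbf a\star\infty=\infty$ and symmetrically (also for $\mathbf a=0$), $\mathbf a\sqcap\infty=\infty\sqcap\mathbf a=\mathbf a$, $(\infty\to\mathbf a)=0$, and $(\mathbf a\to\infty)=\infty$ for $\mathbf a\neq\infty$. **Proposition (further distributivity).** For all Weihrauch degrees $\mathbf a,\mathbf b,\mathbf c$ (including $0$ and $\infty$, except where stated): 1. $\mathbf a\times(\mathbf b\sqcup\mathbf c)=(\mathbf a\times\mathbf b)\sqcup(\mathbf a\times\mathbf c)$ 2. $\mathbf a\star(\mathbf b\sqcup\mathbf c)=(\mathbf a\star\mathbf b)\sqcup(\mathbf a\star\mathbf c)$ 3. $(\mathbf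 b\star\mathbf a)\sqcup(\mathbf c\star\mathbf a)\le_W(\mathbf b\sqcup\mathbf c)\star\mathbf a$ 4. $(\mathbf b\sqcap\mathbf c)\star\mathbf a\le_W(\mathbf b\star\mathbf a)\sqcap(\mathbf c\star\mathbf a)$ 5. $\mathbf a\times(\mathbf b\sqcap\mathbf c)\le_W(\mathbf a\times\mathbf b)\sqcap(\mathbf a\times\mathbf c)$ 6. $\mathbf a\star(\mathbf b\sqcap\mathbf c)=(\mathbf a\star\mathbf b)\sqcap(\mathbf a\star\mathbf c)$ 7. $\mathbf a\sqcup(\mathbf b\times\mathbf c)\le_W(\mathbf a\sqcup\mathbf b)\times(\mathbf a\sqcup\mathbf c)$ 8. $\mathbf a\sqcup(\mathbf b\star\mathbf c)\le_W(\mathbf a\sqcup\mathbf b)\star(\mathbf a\sqcup\mathbf c)$ 9. $\mathbf a\sqcap(\mathbf b\times\mathbf c)\le_W(\mathbf a\sqcap\mathbf b)\times(\mathbf a\sqcap\mathbf c)$, provided that $\mathbf a=\infty$, or $\mathbf b$ and $\mathbf c$ are both $\infty$ or both different from $\infty$ 10. $\mathbf a\to(\mathbf b\sqcup\mathbf c)=(\mathbf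 a\to\mathbf b)\sqcup(\mathbf a\to\mathbf c)$ 11. $(\mathbf a\to\mathbf b)\times(\mathbf a\to\mathbf c)\le_W\mathbf a\to(\mathbf b\times\mathbf c)$, except when $\mathbf a=0$, exactly one of $\mathbf b,\mathbf c$ is $0$, and the other one is not $\infty$ 12. $(\mathbf a\times\mathbf b)\to\mathbf c\le_W(\mathbf a\to\mathbf c)\times(\mathbf b\to\mathbf c)$ 13. $\mathbf a\to(\mathbf b\sqcap\mathbf c)\le_W(\mathbf a\to\mathbf b)\sqcap(\mathbf a\to\mathbf c)$ 14. $(\mathbf a\star\mathbf b)\to\mathbf c\le_W(\mathbf a\to\mathbf c)\star(\mathbf b\to\mathbf c)$ 15. $\mathbf a\times(\mathbf b\star\mathbf c)\le_W(\mathbf a\times\mathbf b)\star(\mathbf a\times\mathbf c)$ In general none of the eleven reductions "$\le_W$" can be replaced by "$=$": for each of (3), (4), (5), (7), (8), (9), (11), (12), (13), (14), (15) there are $\mathbf a,\mathbf b,\mathbf c\notin\{0,\infty\}$ for which the converse reduction fails. Moreover, for each of the following eight reductions there are $\mathbf a,\mathbf b,\mathbf c\notin\{0,\infty\}$ for which it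 fails: 16. $\mathbf a\sqcap(\mathbf b\star\mathbf c)\le_W(\mathbf a\sqcap\mathbf b)\star(\mathbf a\sqcap\mathbf c)$, and its converse 17. $\mathbf a\star(\mathbf b\times\mathbf c)\le_W(\mathbf a\star\mathbf b)\times(\mathbf a\star\mathbf c)$, and its converse 18. $(\mathbf a\to\mathbf b)\star(\mathbf a\to\mathbf c)\le_W\mathbf a\to(\mathbf b\star\mathbf c)$, and its converse 19. $(\mathbf a\times\mathbf b)\star\mathbf c\le_W(\mathbf a\star\mathbf c)\times(\mathbf b\star\mathbf c)$, and its converse -/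

import Mathlib

universe u v w

noncomputable section

namespace Weihrauch

/-! ## Computability on Baire space -/

/-- Baire space, the set of all sequences of natural numbers. -/
abbrev Baire : Type := ℕ → ℕ

/-- The standard pairing of Baire space: `⟨p, q⟩` interleaves `p` and `q`. -/
def pairing (p q : Baire) : Baire := fun n => if n % 2 = 0 then p (n / 2) else q (n / 2)

/-- First projection of the pairing (even positions). -/
def fstB (p : Baire) : Baire := fun n => p (2 * n)

/-- Second projection of the pairing (odd positions). -/
def sndB (p : Baire) : Baire := fun n => p (2 * n + 1)

/-- The sequence without its first entry. -/
def tailB (p : Baire) : Baire := fun n => p (n + 1)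

/-- The sequence `i p` with first entry `i` followed by `p`. -/
def consB (i : ℕ) (p : Baire) : Baire := fun n => if n = 0 then i else p (n - 1)

/-- The code of the finite prefix `q 0, …, q (k - 1)`. -/
def prefixCode (q : Baire) (k : ℕ) : ℕ := Encodable.encode ((List.range k).map q)

/-- The universal partial function `Φ` on Baire space. On input `⟨p, q⟩` the machine computes the
`n`-th output symbol by reading longer and longer prefixes `w` of `q` until `p ⟨n, w⟩ ≠ 0`, and then
writes `p ⟨n, w⟩ - 1`. The value `Φ_p(q)` is defined iff infinitely many symbols are written. Every
Type-2 machine computes a function of the form `Φ_p` with `p` computable, and the functions `Φ_p` for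
arbitrary `p` are the strongly continuous ones. -/
def phi (p : Baire) : Baire →. Baire := fun q =>
  ⟨∀ n, ∃ k, p (Nat.pair n (prefixCode q k)) ≠ 0,
   fun h n => p (Nat.pair n (prefixCode q (Nat.find (h n)))) - 1⟩

/-- A partial function on Baire space is computable iff it is a restriction of some `Φ_p` with `p`
a computable sequence. -/
def ComputablePFun (F : Baire →. Baire) : Prop :=
  ∃ p : Baire, Computable p ∧ ∀ q r, r ∈ F q → r ∈ phi p q

/-! ## Represented spaces -/

/-- A represented space: a set with a partial surjection from Baire space. -/
structure RepSpace : Type (u + 1) where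
  carrier : Type u
  rep : Baire →. carrier
  surj : ∀ x : carrier, ∃ p : Baire, x ∈ rep p

/-- Baire space represented by the identity. -/
def baireSpace : RepSpace.{0} where
  carrier := Baire
  rep := fun p => Part.some p
  surj := fun x => ⟨x, Part.mem_some x⟩

/-- The one-point space with a total representation. -/
def oneSpace : RepSpace.{u} where
  carrier := PUnit.{u + 1}
  rep := fun _ => Part.some PUnit.unit
  surj := fun _ => ⟨fun _ => 0, Part.mem_some _⟩

lemma fstB_pairing (p q : Baire) : fstB (pairing p q) = p := by
  funext n
  simp [fstB, pairing]

lemma sndB_pairing (p q : Baire) : sndB (pairing p q) = q := by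
  funext n
  have h1 : (2 * n + 1) % 2 = 1 := by omega
  have h2 : (2 * n + 1) / 2 = n := by omega
  simp [sndB, pairing, h1, h2]

lemma tailB_consB (i : ℕ) (p : Baire) : tailB (consB i p) = p := by
  funext n
  simp [tailB, consB]

/-- The product of represented spaces: `⟨p, q⟩` is a name of `(x, y)` iff `p` is a name of `x` and
`q` is a name of `y`. -/
def prodSpace (X : RepSpace.{u}) (Y : RepSpace.{v}) : RepSpace.{max u v} where
  carrier := X.carrier × Y.carrier
  rep := fun p => (X.rep (fstB p)).bind fun x => (Y.rep (sndB p)).map fun y => (x, y)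
  surj := by
    rintro ⟨x, y⟩
    obtain ⟨p, hp⟩ := X.surj x
    obtain ⟨q, hq⟩ := Y.surj y
    refine ⟨pairing p q, ?_⟩
    rw [fstB_pairing, sndB_pairing]
    exact Part.mem_bind hp (Part.mem_map _ hq)

/-- The coproduct of represented spaces: `0p` is a name of `(0, x)` iff `p` is a name of `x`, and
`1p` is a name of `(1, y)` iff `p` is a name of `y`. -/
def sumSpace (X : RepSpace.{u}) (Y : RepSpace.{v}) : RepSpace.{max u v} where
  carrier := X.carrier ⊕ Y.carrier
  rep := fun p =>
    if p 0 = 0 then (X.rep (tailB p)).map Sum.inl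
    else if p 0 = 1 then (Y.rep (tailB p)).map Sum.inr
    else Part.none
  surj := by
    rintro (x | y)
    · obtain ⟨p, hp⟩ := X.surj x
      refine ⟨consB 0 p, ?_⟩
      simpa [tailB_consB, consB] using hp
    · obtain ⟨p, hp⟩ := Y.surj y
      refine ⟨consB 1 p, ?_⟩
      simpa [tailB_consB, consB] using hp

/-- The cylindrification of a representation: `⟨p, q⟩` is a name of `x` iff `p` is. -/
def cylRep (X : RepSpace.{u}) : Baire →. X.carrier := fun p => X.rep (fstB p)

/-! ## Multi-valued functions -/

/-- A partial multi-valued function from `X` to `Y`, given by its sets of values. The points outside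
of the domain are those with no value. -/
abbrev MV (X : RepSpace.{u}) (Y : RepSpace.{v}) : Type (max u v) := X.carrier → Set Y.carrier

/-- The domain of a multi-valued function. -/
def MV.dom {X : RepSpace.{u}} {Y : RepSpace.{v}} (f : MV X Y) : Set X.carrier :=
  {x | (f x).Nonempty}

/-- Composition of multi-valued functions: `(f ∘ g)(x)` is defined only if `g(x)` is non-empty and
all points of `g(x)` are in the domain of `f`. -/
def MV.comp {X : RepSpace.{u}} {Y : RepSpace.{v}} {Z : RepSpace.{w}} (f : MV Y Z) (g : MV X Y) :
    MV X Z :=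
  fun x => {z | g x ⊆ f.dom ∧ ∃ y ∈ g x, z ∈ f y}

/-- The multi-valued function `Φ_p^{X,Y} = δ_Y ∘ Φ_p ∘ (δ_X^cyl)⁻¹`. -/
def phiMV (X : RepSpace.{u}) (Y : RepSpace.{v}) (p : Baire) : MV X Y := fun x =>
  {y | (∀ q, x ∈ cylRep X q → ∃ r ∈ phi p q, (Y.rep r).Dom) ∧
    ∃ q, x ∈ cylRep X q ∧ ∃ r ∈ phi p q, y ∈ Y.rep r}

/-- The represented space `M(X, Y)` of strongly continuous multi-valued functions; `p` is a name of
`Φ_p^{X,Y}`. -/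
def mSpace (X : RepSpace.{u}) (Y : RepSpace.{v}) : RepSpace.{max u v} where
  carrier := {f : MV X Y // ∃ p : Baire, f = phiMV X Y p}
  rep := fun p => Part.some ⟨phiMV X Y p, p, rfl⟩
  surj := by
    rintro ⟨f, p, rfl⟩
    exact ⟨p, Part.mem_some _⟩

/-- A multi-valued function on represented spaces, bundled with its source and target. -/
structure Problem : Type (u + 1) where
  src : RepSpace.{u}
  tgt : RepSpace.{u}
  map : MV src tgt

/-- `F` is a realizer of `f`. -/
def Realizes (F : Baire →. Baire) (f : Problem.{u}) : Prop :=
  ∀ p x, x ∈ f.src.rep p → x ∈ f.map.dom → ∃ r ∈ F p, ∃ y ∈ f.tgt.rep r, y ∈ f.map x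

/-- The partial function `K⟨id, GH⟩`. -/
def wrap (K G H : Baire →. Baire) : Baire →. Baire := fun p =>
  (H p).bind fun h => (G h).bind fun g => K (pairing p g)

/-- Weihrauch reducibility of multi-valued functions on represented spaces. -/
def Problem.Reduces (f g : Problem.{u}) : Prop :=
  ∃ K H : Baire →. Baire, ComputablePFun K ∧ ComputablePFun H ∧
    ∀ G : Baire →. Baire, Realizes G g → Realizes (wrap K G H) f

namespace Problem

/-- The nowhere defined multi-valued function. -/
def zero : Problem.{u} where
  src := oneSpace
  tgt := oneSpace
  map := fun _ => ∅

/-- `f ⊔ g`. -/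
def sup (f g : Problem.{u}) : Problem.{u} where
  src := sumSpace f.src g.src
  tgt := sumSpace f.tgt g.tgt
  map := fun s => Sum.elim (fun x => Sum.inl '' f.map x) (fun y => Sum.inr '' g.map y) s

/-- `f × g`. -/
def times (f g : Problem.{u}) : Problem.{u} where
  src := prodSpace f.src g.src
  tgt := prodSpace f.tgt g.tgt
  map := fun s => f.map s.1 ×ˢ g.map s.2

/-- `f ⊓ g`: both instances are given and one of them is answered. Its domain is
`dom f × dom g`. -/
def inf (f g : Problem.{u}) : Problem.{u} where
  src := prodSpace f.src g.src
  tgt := sumSpace f.tgt g.tgt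
  map := fun s => {z | s.1 ∈ f.map.dom ∧ s.2 ∈ g.map.dom ∧
    z ∈ Sum.inl '' f.map s.1 ∪ Sum.inr '' g.map s.2}

/-- `id × f`, where `id` is the identity of Baire space. -/
def idTimes (f : Problem.{u}) : MV (prodSpace baireSpace f.src) (prodSpace baireSpace f.tgt) :=
  fun s => {s.1} ×ˢ f.map s.2

/-- The transposition `(h, x) ↦ (h ∘ g)(x)` of `g` with respect to `U`. -/
def transpose (g : Problem.{u}) (U : RepSpace.{u}) : MV (prodSpace (mSpace g.tgt U) g.src) U :=
  fun s => MV.comp s.1.1 g.map s.2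

/-- The compositional product `f ⋆ g = (id × f) ∘ gᵗ`. -/
def star (f g : Problem.{u}) : Problem.{u} where
  src := prodSpace (mSpace g.tgt (prodSpace baireSpace f.src)) g.src
  tgt := prodSpace baireSpace f.tgt
  map := MV.comp (idTimes f) (transpose g (prodSpace baireSpace f.src))

/-- The implication `g → f` as a multi-valued function: `(H, x)` is a value at `u` in `dom f` iff
`H ∘ g` is defined at `x` and `(H ∘ g)(x) ⊆ f(u)`. -/
def impl (g f : Problem.{u}) : Problem.{u} where
  src := f.src
  tgt := prodSpace (mSpace g.tgt f.tgt) g.src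
  map := fun s => {t | s ∈ f.map.dom ∧ t.2 ∈ (MV.comp t.1.1 g.map).dom ∧
    MV.comp t.1.1 g.map t.2 ⊆ f.map s}

end Problem

/-! ## The Weihrauch degrees with the additional top element -/

/-- Representatives of Weihrauch degrees: the multi-valued functions on represented spaces, and an
additional top element `∞`. -/
inductive WProblem : Type (u + 1) where
  | fn (f : Problem.{u}) : WProblem
  | infty : WProblem

namespace WProblem

/-- The order of the Weihrauch degrees, on representatives; `∞` is strictly above everything. -/
def le : WProblem.{u} → WProblem.{u} → Prop
  | fn f, fn g => f.Reduces g
  | _, infty => True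
  | infty, fn _ => False

/-- Equality of Weihrauch degrees, on representatives. -/
def equiv (a b : WProblem.{u}) : Prop := a.le b ∧ b.le a

/-- The degree `0` of the nowhere defined multi-valued function. -/
def zero : WProblem.{u} := fn Problem.zero

/-- `a ⊔ b`, with `a ⊔ ∞ = ∞ ⊔ a = ∞`. -/
def sup : WProblem.{u} → WProblem.{u} → WProblem.{u}
  | fn f, fn g => fn (f.sup g)
  | _, _ => infty

/-- `a ⊓ b`, with `a ⊓ ∞ = ∞ ⊓ a = a`. -/
def inf : WProblem.{u} → WProblem.{u} → WProblem.{u}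
  | fn f, fn g => fn (f.inf g)
  | a, infty => a
  | infty, b => b

/-- `a × b`, with `a × ∞ = ∞ × a = ∞`. -/
def times : WProblem.{u} → WProblem.{u} → WProblem.{u}
  | fn f, fn g => fn (f.times g)
  | _, _ => infty

/-- `a ⋆ b`, with `a ⋆ ∞ = ∞ ⋆ a = ∞`. -/
def star : WProblem.{u} → WProblem.{u} → WProblem.{u}
  | fn f, fn g => fn (f.star g)
  | _, _ => infty

open Classical in
/-- `a → b`, with `(∞ → b) = 0`, `(a → ∞) = ∞` for `a ≠ ∞`, and `(0 → b) = ∞` for `b ≠ 0`. -/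
def impl : WProblem.{u} → WProblem.{u} → WProblem.{u}
  | infty, _ => zero
  | fn _, infty => infty
  | fn g, fn f => if g.map.dom.Nonempty ∨ f.map.dom = ∅ then fn (g.impl f) else infty

/-- A degree is proper iff it is neither `0` nor `∞`. -/
def Proper (a : WProblem.{u}) : Prop := ¬ a.equiv zero ∧ ¬ a.equiv infty

end WProblem

end Weihrauch

end

infix:50 " ≤w " => Weihrauch.WProblem.le
infix:50 " ≡w " => Weihrauch.WProblem.equiv
infixl:65 " ⊔w " => Weihrauch.WProblem.sup
infixl:65 " ⊓w " => Weihrauch.WProblem.inf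
infixl:70 " ×w " => Weihrauch.WProblem.times
infixl:70 " ⋆w " => Weihrauch.WProblem.star
infixr:60 " ⇒w " => Weihrauch.WProblem.impl
notation "∞w" => Weihrauch.WProblem.infty
notation "zero_w" => Weihrauch.WProblem.zero

open Weihrauch

noncomputable section

namespace Weihrauch

/-! ## Closure properties of the computable functions on Baire space -/

/-! Weihrauch reducibility depends only on names, so a problem is treated as the relation `sol`
between names of instances and names of solutions, and every operation is described at that level.
An instance of `f ⋆ g` is a program together with an instance of `g`; the program turns every
solution of that instance into data to be passed on and an instance of `f`. A solution of `g → f` is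
likewise a program and an instance of `g`, the program turning every solution into a solution of the
given instance of `f`.

The positive statements become explicit transformations by total computable functions
(`TotReduces`). Many follow from the lattice properties of `⊔` and `⊓` and from monotonicity
(`times_mono`, `star_mono`, `impl_mono`). The others rewrite programs, which the smn-theorem makes
computable (`exists_curry_phi`). The degrees `0` and `∞` are then treated by cases.

The negative statements rest on Turing degrees. A reduction sends a recursive instance to a
recursive instance, and whatever computes a solution of the latter computes one of the former
(`exists_recursive`). Baire category gives Turing incomparable `A` and `B`, and counting gives `E`
not computable from both together. The counterexamples have one or two instances, built from `A`,
`B`, `E` and constants. Each time the target either has no suitable recursive instance, or gives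
away too little: it answers with `A` alone, say, where the source demands `B`. -/

/-- The finite prefix of length `k`. -/
def pre (q : Baire) (k : ℕ) : List ℕ := (List.range k).map q

lemma prefixCode_eq (q : Baire) (k : ℕ) : prefixCode q k = Encodable.encode (pre q k) := rfl

@[simp] lemma length_pre (q : Baire) (k : ℕ) : (pre q k).length = k := by simp [pre]

lemma pre_getElem? (q : Baire) {k n : ℕ} (h : n < k) : (pre q k)[n]? = some (q n) := by
  simp [pre, h]

lemma take_pre (q : Baire) {j k : ℕ} (h : j ≤ k) : (pre q k).take j = pre q j := by
  simp [pre, ← List.map_take, List.take_range, h]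

lemma pre_succ (q : Baire) (k : ℕ) : pre q (k + 1) = pre q k ++ [q k] := by
  simp [pre, List.range_succ]

lemma mem_phi_iff {p q r : Baire} : r ∈ phi p q ↔
    ∀ n, ∃ k, p (Nat.pair n (prefixCode q k)) = r n + 1 ∧
      ∀ j < k, p (Nat.pair n (prefixCode q j)) = 0 := by
  classical
  constructor
  · rintro ⟨h, rfl⟩ n
    refine ⟨Nat.find (h n), ?_, fun j hj => not_not.1 (Nat.find_min (h n) hj)⟩
    have := Nat.find_spec (h n)
    simp only [phi]
    omega
  · intro h
    have hd : ∀ n, ∃ k, p (Nat.pair n (prefixCode q k)) ≠ 0 := fun n => by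
      obtain ⟨k, hk, -⟩ := h n
      exact ⟨k, by omega⟩
    refine ⟨hd, funext fun n => ?_⟩
    obtain ⟨k, hk, hj⟩ := h n
    have : Nat.find (hd n) = k := (Nat.find_eq_iff (hd n)).2 ⟨by omega, fun j h' => by simp [hj j h']⟩
    simp [phi, this, hk]

/-- `search g K` is `v` if the first `k < K` with `g k ≠ some 0` has `g k = some (v + 1)`. -/
def search (g : ℕ → Option ℕ) (K : ℕ) : Option ℕ :=
  (Nat.rec (some 0) (fun j acc => acc.bind fun v => Nat.casesOn v (g j) fun m => some (m + 1)) K :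
    Option ℕ).bind fun v => Nat.casesOn v none some

/-- The accumulator is `some 0` while all answers were zero, freezes at `some (v + 1)` at the first
positive answer, and becomes `none` if an undefined answer is met before that. -/
lemma search_eq_some {g : ℕ → Option ℕ} {K v : ℕ} :
    search g K = some v ↔ ∃ k < K, g k = some (v + 1) ∧ ∀ j < k, g j = some 0 := by
  set f : ℕ → Option ℕ := fun K =>
    Nat.rec (some 0) (fun j acc => acc.bind fun v => Nat.casesOn v (g j) fun m => some (m + 1)) K
    with hf
  have f0 : f 0 = some 0 := rfl
  have fs : ∀ K, f (K + 1) = (f K).bind fun v => Nat.casesOn v (g K) fun m => some (m + 1) :=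
    fun _ => rfl
  have h0 : ∀ K, f K = some 0 ↔ ∀ j < K, g j = some 0 := by
    intro K
    induction K with
    | zero => simp [f0]
    | succ K ih =>
      rw [fs, Nat.forall_lt_succ_right, ← ih]
      rcases f K with _ | _ | v <;> simp
  have h1 : ∀ K, f K = some (v + 1) ↔ ∃ k < K, g k = some (v + 1) ∧ ∀ j < k, g j = some 0 := by
    intro K
    induction K with
    | zero => simp [f0]
    | succ K ih =>
      rw [fs, Nat.exists_lt_succ_right, ← ih, ← h0]
      rcases f K with _ | _ | v <;> simp
  rw [← h1]
  change ((f K).bind _) = _ ↔ _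
  rcases f K with _ | _ | v <;> simp

lemma computable_search {α : Type*} [Primcodable α] {g : α → ℕ → Option ℕ} {K : α → ℕ}
    (hg : Computable₂ g) (hK : Computable K) : Computable fun a => search (g a) (K a) := by
  refine Computable.option_bind (Computable.nat_rec (h := fun a (x : ℕ × Option ℕ) => x.2.bind fun v =>
    Nat.casesOn v (g a x.1) fun m => some (m + 1)) hK (Computable.const _) ?_) ?_
  · refine Computable.option_bind (Computable.snd.comp Computable.snd) ?_
    refine Computable.nat_casesOn Computable.snd ?_ ?_
    · exact hg.comp (Computable.fst.comp Computable.fst)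
        (Computable.fst.comp (Computable.snd.comp Computable.fst))
    · exact Computable.option_some.comp (Computable.succ.comp Computable.snd)
  · exact Computable.nat_casesOn Computable.snd (Computable.const _)
      (Computable.option_some.comp Computable.snd)

/-- `G` computes the symbols of the values of `F` from the finite prefixes of the argument. -/
def Approximates (G : List ℕ → ℕ → Option ℕ) (F : Baire →. Baire) : Prop :=
  ∀ q r, r ∈ F q → ∀ n, (∃ k₀, ∀ k ≥ k₀, G (pre q k) n = some (r n)) ∧
    ∀ k v, G (pre q k) n = some v → v = r n

/-- The name of `F` has entry `0` where `G` is still silent and `v + 1` where `G` answers `v`. The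
first answer can be trusted because no prefix produces a wrong one. -/
lemma Approximates.computablePFun {G : List ℕ → ℕ → Option ℕ} {F : Baire →. Baire}
    (hG : Computable₂ G) (h : Approximates G F) : ComputablePFun F := by
  refine ⟨fun m => Option.casesOn
    (G ((Encodable.decode (α := List ℕ) m.unpair.2).getD []) m.unpair.1) 0 Nat.succ, ?_, ?_⟩
  · refine Computable.option_casesOn (hG.comp ?_ ?_) (Computable.const _)
      (Computable.succ.comp Computable.snd)
    · exact Computable.option_getD
        (Computable.decode.comp (Computable.snd.comp Computable.unpair)) (Computable.const _)
    · exact Computable.fst.comp Computable.unpair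
  · intro q r hr
    rw [mem_phi_iff]
    intro n
    obtain ⟨⟨k₀, hk₀⟩, hv⟩ := h q r hr n
    classical
    have hex : ∃ k, G (pre q k) n ≠ none := ⟨k₀, by simp [hk₀ k₀ le_rfl]⟩
    refine ⟨Nat.find hex, ?_, fun j hj => ?_⟩
    · obtain ⟨v, hv'⟩ := Option.ne_none_iff_exists'.1 (Nat.find_spec hex)
      simp [prefixCode_eq, hv', hv _ _ hv']
    · have := not_not.1 (Nat.find_min hex hj)
      simp [prefixCode_eq, this]

/-- The machine is run on all prefixes of the available word. The bound is `w.length + 1` because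
the search stays strictly below it and the whole word must be included. -/
lemma ComputablePFun.exists_approximates {F : Baire →. Baire} (h : ComputablePFun F) :
    ∃ G : List ℕ → ℕ → Option ℕ, Computable₂ G ∧ Approximates G F := by
  obtain ⟨p, hp, hF⟩ := h
  refine ⟨fun (w : List ℕ) (n : ℕ) => search (fun j => some (p (Nat.pair n (Encodable.encode (w.take j)))))
    (w.length + 1), ?_, ?_⟩
  · refine computable_search (Computable.option_some.comp (hp.comp ?_))
      (Computable.succ.comp (Computable.list_length.comp Computable.fst))
    exact Primrec₂.natPair.to_comp.comp (Computable.snd.comp Computable.fst)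
      (Computable.encode.comp (Primrec.list_take.to_comp.comp Computable.snd
        (Computable.fst.comp Computable.fst)))
  · intro q r hr n
    obtain ⟨k₀, hk₀, hj⟩ := mem_phi_iff.1 (hF q r hr) n
    simp only [prefixCode_eq] at hk₀ hj
    refine ⟨⟨k₀, fun k hk => ?_⟩, fun k v hv => ?_⟩
    · rw [search_eq_some]
      refine ⟨k₀, by simpa using Nat.lt_succ_of_le hk, ?_, fun j hj' => ?_⟩
      · rw [take_pre q hk, hk₀]
      · rw [take_pre q (by omega), hj j hj']
    · obtain ⟨i, hi, h1, h2⟩ := search_eq_some.1 hv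
      rw [length_pre] at hi
      rw [take_pre q (by omega), Option.some_inj] at h1
      have h2' : ∀ j < i, p (Nat.pair n (Encodable.encode (pre q j))) = 0 := fun j hj' => by
        have := h2 j hj'
        rwa [take_pre q (by omega), Option.some_inj] at this
      rcases lt_trichotomy i k₀ with h | h | h
      · have := hj i h; omega
      · subst h; omega
      · have := h2' _ h; omega

/-- The list of the first `m` symbols that `G` produces. -/
def approxPre (G : ℕ → Option ℕ) (m : ℕ) : Option (List ℕ) :=
  Nat.rec (some []) (fun i acc => acc.bind fun l => (G i).map fun x => l ++ [x]) m

lemma computable_approxPre {α : Type*} [Primcodable α] {g : α → ℕ → Option ℕ} {K : α → ℕ}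
    (hg : Computable₂ g) (hK : Computable K) : Computable fun a => approxPre (g a) (K a) := by
  refine Computable.nat_rec (h := fun a (x : ℕ × Option (List ℕ)) =>
    x.2.bind fun l => (g a x.1).map fun y => l ++ [y])
    hK (Computable.const _) ?_
  refine Computable.option_bind (Computable.snd.comp Computable.snd) ?_
  refine Computable.option_map (hg.comp (Computable.fst.comp Computable.fst)
    (Computable.fst.comp (Computable.snd.comp Computable.fst))) ?_
  exact Computable.list_concat.comp (Computable.snd.comp Computable.fst) Computable.snd

lemma approxPre_eq {G : ℕ → Option ℕ} {r : Baire} {m : ℕ} (h : ∀ n < m, G n = some (r n)) :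
    approxPre G m = some (pre r m) := by
  induction m with
  | zero => rfl
  | succ m ih =>
    change (approxPre G m).bind _ = _
    rw [ih fun n hn => h n (by omega), pre_succ]
    simp [h m]

lemma eq_of_approxPre {G : ℕ → Option ℕ} {r : Baire} {m : ℕ} {l : List ℕ}
    (h : ∀ n v, G n = some v → v = r n) (hl : approxPre G m = some l) : l = pre r m := by
  induction m generalizing l with
  | zero => simpa [approxPre, pre, eq_comm] using hl
  | succ m ih =>
    change (approxPre G m).bind _ = _ at hl
    simp only [Option.bind_eq_some_iff, Option.map_eq_some_iff] at hl
    obtain ⟨l', h1, x, h2, rfl⟩ := hl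
    rw [ih h1, h m x h2, pre_succ]

/-- The program `a` and the input `b` are themselves only being computed from `q`. The search for an
output symbol consults finitely many entries of `a` and `b`, so a long enough prefix of `q`
determines all of them. -/
lemma ComputablePFun.app {A B : Baire →. Baire} (hA : ComputablePFun A) (hB : ComputablePFun B) :
    ComputablePFun fun q => (A q).bind fun a => (B q).bind fun b => phi a b := by
  obtain ⟨GA, cA, hA⟩ := hA.exists_approximates
  obtain ⟨GB, cB, hB⟩ := hB.exists_approximates
  refine Approximates.computablePFun (G := fun w n => search (fun j => (approxPre (GB w) j).bind
    fun l => GA w (Nat.pair n (Encodable.encode l))) (w.length + 1)) ?_ ?_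
  · refine computable_search (Computable.option_bind (computable_approxPre
      (cB.comp (Computable.fst.comp (Computable.fst.comp Computable.fst)) Computable.snd)
      Computable.snd) ?_)
      (Computable.succ.comp (Computable.list_length.comp Computable.fst))
    exact cA.comp (Computable.fst.comp (Computable.fst.comp Computable.fst))
      (Primrec₂.natPair.to_comp.comp (Computable.snd.comp (Computable.fst.comp Computable.fst))
        (Computable.encode.comp Computable.snd))
  · intro q r hr n
    simp only [Part.mem_bind_iff] at hr
    obtain ⟨a, ha, b, hb, hr⟩ := hr
    specialize hA q a ha
    specialize hB q b hb
    obtain ⟨k₀, hk₀, hj⟩ := mem_phi_iff.1 hr n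
    simp only [prefixCode_eq] at hk₀ hj
    constructor
    · choose eA heA using fun n => (hA n).1
      choose eB heB using fun n => (hB n).1
      -- The summands cover the length of the search, the symbols of `b` it reads, and the entries
      -- of `a` it queries.
      refine ⟨k₀ + (Finset.range (k₀ + 1)).sup eB + (Finset.range (k₀ + 1)).sup
        (fun j => eA (Nat.pair n (Encodable.encode (pre b j)))), fun k hk => ?_⟩
      have key : ∀ j ≤ k₀, ((approxPre (GB (pre q k)) j).bind
          fun l => GA (pre q k) (Nat.pair n (Encodable.encode l))) =
          some (a (Nat.pair n (Encodable.encode (pre b j)))) := by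
        intro j hj
        rw [approxPre_eq (r := b)]
        · apply heA
          have := Finset.le_sup (f := fun j => eA (Nat.pair n (Encodable.encode (pre b j))))
            (Finset.mem_range.2 (show j < k₀ + 1 by omega))
          omega
        · intro i hi
          apply heB
          have := Finset.le_sup (f := eB) (Finset.mem_range.2 (show i < k₀ + 1 by omega))
          omega
      rw [search_eq_some]
      refine ⟨k₀, by rw [length_pre]; omega, ?_, fun j hj' => ?_⟩
      · rw [key _ le_rfl, hk₀]
      · rw [key _ hj'.le, hj j hj']
    · intro k v hv
      obtain ⟨i, -, h1, h2⟩ := search_eq_some.1 hv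
      have key : ∀ j x, ((approxPre (GB (pre q k)) j).bind
          fun l => GA (pre q k) (Nat.pair n (Encodable.encode l))) = some x →
          x = a (Nat.pair n (Encodable.encode (pre b j))) := by
        intro j x hx
        obtain ⟨l, hl, hx⟩ := Option.bind_eq_some_iff.1 hx
        rw [eq_of_approxPre (fun n v => (hB n).2 k v) hl] at hx
        exact (hA _).2 k _ hx
      have h1 := key _ _ h1
      have h2 := fun j hj => key _ _ (h2 j hj)
      rcases lt_trichotomy i k₀ with h | h | h
      · have := hj i h; omega
      · subst h; omega
      · have := h2 _ h; omega

lemma ComputablePFun.reindex {F : Baire →. Baire} (hF : ComputablePFun F) {u : ℕ → ℕ}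
    (hu : Computable u) : ComputablePFun fun q => (F q).map fun r n => r (u n) := by
  obtain ⟨G, cG, hG⟩ := hF.exists_approximates
  refine Approximates.computablePFun (G := fun w n => G w (u n))
    (cG.comp Computable.fst (hu.comp Computable.snd)) ?_
  intro q r hr n
  obtain ⟨r', hr', rfl⟩ := (Part.mem_map_iff _).1 hr
  exact hG q r' hr' (u n)

lemma ComputablePFun.cons {F : Baire →. Baire} (hF : ComputablePFun F) (i : ℕ) :
    ComputablePFun fun q => (F q).map (consB i) := by
  obtain ⟨G, cG, hG⟩ := hF.exists_approximates
  refine Approximates.computablePFun (G := fun w n => Nat.casesOn n (some i) (G w)) ?_ ?_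
  · exact Computable.nat_casesOn Computable.snd (Computable.const _)
      (cG.comp (Computable.fst.comp Computable.fst) Computable.snd)
  intro q r hr n
  obtain ⟨r', hr', rfl⟩ := (Part.mem_map_iff _).1 hr
  rcases n with _ | n
  · exact ⟨⟨0, fun _ _ => rfl⟩, fun k v h => (Option.some_inj.1 h).symm⟩
  · exact hG q r' hr' n

lemma ComputablePFun.pairing {A B : Baire →. Baire} (hA : ComputablePFun A)
    (hB : ComputablePFun B) :
    ComputablePFun fun q => (A q).bind fun a => (B q).map fun b => pairing a b := by
  obtain ⟨GA, cA, hA⟩ := hA.exists_approximates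
  obtain ⟨GB, cB, hB⟩ := hB.exists_approximates
  refine Approximates.computablePFun (G := fun w n => Nat.casesOn (n % 2) (GA w (n / 2))
    fun _ => GB w (n / 2)) ?_ ?_
  · have hd : Computable fun n : ℕ => n / 2 :=
      (Primrec.nat_div.comp Primrec.id (Primrec.const 2)).to_comp
    have hm : Computable fun n : ℕ => n % 2 :=
      (Primrec.nat_mod.comp Primrec.id (Primrec.const 2)).to_comp
    exact Computable.nat_casesOn (hm.comp Computable.snd)
      (cA.comp Computable.fst (hd.comp Computable.snd))
      (cB.comp (Computable.fst.comp Computable.fst)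
        (hd.comp (Computable.snd.comp Computable.fst)))
  intro q r hr n
  simp only [Part.mem_bind_iff, Part.mem_map_iff] at hr
  obtain ⟨a, ha, b, hb, rfl⟩ := hr
  rcases Nat.mod_two_eq_zero_or_one n with h | h
  · simpa [Weihrauch.pairing, h] using hA q a ha (n / 2)
  · simpa [Weihrauch.pairing, h] using hB q b hb (n / 2)

lemma ComputablePFun.ite {C A B : Baire →. Baire} (hC : ComputablePFun C) (hA : ComputablePFun A)
    (hB : ComputablePFun B) :
    ComputablePFun fun q => (C q).bind fun c => if c 0 = 0 then A q else B q := by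
  obtain ⟨GC, cC, hC⟩ := hC.exists_approximates
  obtain ⟨GA, cA, hA⟩ := hA.exists_approximates
  obtain ⟨GB, cB, hB⟩ := hB.exists_approximates
  refine Approximates.computablePFun (G := fun w n => (GC w 0).bind fun v =>
    Nat.casesOn v (GA w n) fun _ => GB w n) ?_ ?_
  · refine Computable.option_bind (cC.comp Computable.fst (Computable.const 0)) ?_
    exact Computable.nat_casesOn Computable.snd
      (cA.comp (Computable.fst.comp Computable.fst) (Computable.snd.comp Computable.fst))
      (cB.comp (Computable.fst.comp (Computable.fst.comp Computable.fst))
        (Computable.snd.comp (Computable.fst.comp Computable.fst)))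
  intro q r hr n
  obtain ⟨c, hc, hr⟩ := Part.mem_bind_iff.1 hr
  obtain ⟨⟨k₀, hk₀⟩, hv⟩ := hC q c hc 0
  -- Withholding finitely many answers does not spoil an approximation; here these are the ones
  -- before the test symbol is known.
  have key : ∀ G : List ℕ → ℕ → Option ℕ, (∃ k₀, ∀ k ≥ k₀, G (pre q k) n = some (r n)) ∧
      (∀ k v, G (pre q k) n = some v → v = r n) → ∀ G' : List ℕ → ℕ → Option ℕ,
      (∀ k, (G' (pre q k) n = none ∧ k < k₀) ∨ G' (pre q k) n = G (pre q k) n) →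
      (∃ k₀, ∀ k ≥ k₀, G' (pre q k) n = some (r n)) ∧
      (∀ k v, G' (pre q k) n = some v → v = r n) := by
    rintro G ⟨⟨k₁, hk₁⟩, h⟩ G' hG'
    refine ⟨⟨k₀ + k₁, fun k hk => ?_⟩, fun k v hv => ?_⟩
    · rcases hG' k with h' | h'
      · omega
      · rw [h', hk₁ k (by omega)]
    · rcases hG' k with h' | h'
      · simp [h'.1] at hv
      · exact h k v (by rw [← h', hv])
  have hval : ∀ k, (GC (pre q k) 0 = none ∧ k < k₀) ∨ GC (pre q k) 0 = some (c 0) := by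
    intro k
    cases hg : GC (pre q k) 0 with
    | none =>
      refine Or.inl ⟨rfl, not_le.1 fun hk => ?_⟩
      rw [hk₀ k hk] at hg
      simp at hg
    | some v => exact Or.inr (by rw [hv k v hg])
  split_ifs at hr with h0
  · refine key GA (hA q r hr n) (fun w n => (GC w 0).bind fun v =>
      Nat.casesOn v (GA w n) fun _ => GB w n) fun k => ?_
    rcases hval k with h | h
    · exact Or.inl ⟨by simp [h.1], h.2⟩
    · exact Or.inr (by simp [h, h0])
  · obtain ⟨m, hm⟩ := Nat.exists_eq_succ_of_ne_zero h0
    refine key GB (hB q r hr n) (fun w n => (GC w 0).bind fun v =>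
      Nat.casesOn v (GA w n) fun _ => GB w n) fun k => ?_
    rcases hval k with h | h
    · exact Or.inl ⟨by simp [h.1], h.2⟩
    · exact Or.inr (by simp [h, hm])

lemma ComputablePFun.some_id : ComputablePFun fun q => Part.some q := by
  refine Approximates.computablePFun (G := fun w n => w[n]?) Computable.list_getElem? ?_
  intro q r hr n
  rw [Part.mem_some_iff] at hr
  subst hr
  refine ⟨⟨n + 1, fun k hk => pre_getElem? _ (by omega)⟩, fun k v hv => ?_⟩
  by_cases h : n < k
  · simp only [pre_getElem? _ h] at hv
    exact (Option.some_inj.1 hv).symm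
  · simp [List.getElem?_eq_none (show (pre r k).length ≤ n by simpa using h)] at hv

lemma ComputablePFun.const {c : Baire} (hc : Computable c) :
    ComputablePFun fun _ => Part.some c := by
  refine Approximates.computablePFun (G := fun _ n => some (c n))
    (Computable.option_some.comp (hc.comp Computable.snd)) ?_
  intro q r hr n
  rw [Part.mem_some_iff] at hr
  subst hr
  exact ⟨⟨0, fun _ _ => rfl⟩, fun k v h => (Option.some_inj.1 h).symm⟩

/-- The interleaving of a prefix with a prefix that is at least as long. -/
def interleave (l w : List ℕ) : List ℕ :=
  (List.range (2 * w.length)).map fun i => if i % 2 = 0 then l.getD (i / 2) 0 else w.getD (i / 2) 0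

lemma interleave_pre (p q : Baire) {j k : ℕ} (h : k ≤ j) :
    interleave (pre p j) (pre q k) = pre (pairing p q) (2 * k) := by
  unfold interleave
  rw [length_pre]
  refine List.map_congr_left fun i hi => ?_
  rw [List.mem_range] at hi
  have h1 : i / 2 < k := by omega
  have h2 : i / 2 < j := by omega
  simp [pairing, pre, h1, h2]

lemma computable_interleave : Computable₂ interleave := by
  refine Primrec.to_comp (Primrec.list_map (Primrec.list_range.comp
    (Primrec.nat_mul.comp (Primrec.const 2) (Primrec.list_length.comp Primrec.snd))) ?_)
  have hd : Primrec fun x : (List ℕ × List ℕ) × ℕ => x.2 / 2 :=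
    Primrec.nat_div.comp Primrec.snd (Primrec.const 2)
  refine Primrec.ite (Primrec.eq.comp (Primrec.nat_mod.comp Primrec.snd (Primrec.const 2))
    (Primrec.const 0)) ?_ ?_
  · exact (Primrec.list_getD 0).comp (Primrec.fst.comp Primrec.fst) hd
  · exact (Primrec.list_getD 0).comp (Primrec.snd.comp Primrec.fst) hd

/-- A total function on Baire space that is computable. -/
def ComputableFun (f : Baire → Baire) : Prop := ComputablePFun fun q => Part.some (f q)

/-- The smn-theorem for `phi`. -/
lemma ComputablePFun.exists_curry {F : Baire →. Baire} (hF : ComputablePFun F) :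
    ∃ T : Baire → Baire, ComputableFun T ∧
      ∀ p q r, r ∈ F (Weihrauch.pairing p q) → r ∈ phi (T p) q := by
  obtain ⟨G, cG, hG⟩ := hF.exists_approximates
  set dec : ℕ → List ℕ := fun m => (Encodable.decode (α := List ℕ) m.unpair.2).getD [] with hdec
  have cdec : Computable dec := Computable.option_getD
    (Computable.decode.comp (Computable.snd.comp Computable.unpair)) (Computable.const _)
  set val : List ℕ → ℕ → ℕ := fun l m =>
    Option.casesOn (G (interleave l (dec m)) m.unpair.1) 0 Nat.succ with hval
  have cval : Computable₂ val := by
    refine Computable.option_casesOn (cG.comp (computable_interleave.comp Computable.fst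
      (cdec.comp Computable.snd)) (Computable.fst.comp (Computable.unpair.comp Computable.snd)))
      (Computable.const _) (Computable.succ.comp Computable.snd)
  -- A query about a word of length `k` read from `q` uses just the first `k` symbols of `p`, so `T
  -- p` is total. Only prefixes of even length of the pair are inspected, which suffices since `G`
  -- answers on all long prefixes.
  refine ⟨fun p m => val (pre p (dec m).length) m, ?_, ?_⟩
  · refine Approximates.computablePFun (G := fun l m =>
      bif decide ((dec m).length ≤ l.length) then some (val l m) else none) ?_ ?_
    · have cle : Computable₂ fun a b : ℕ => decide (a ≤ b) := Primrec.nat_le.decide.to_comp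
      exact Computable.cond (cle.comp (Computable.list_length.comp (cdec.comp Computable.snd))
        (Computable.list_length.comp Computable.fst)) (Computable.option_some.comp cval)
        (Computable.const _)
    · intro q r hr m
      rw [Part.mem_some_iff] at hr
      subst hr
      have key : ∀ k, (dec m).length ≤ k → val (pre q k) m = val (pre q (dec m).length) m := by
        intro k hk
        have : interleave (pre q k) (dec m) = interleave (pre q (dec m).length) (dec m) := by
          have hl : dec m = pre (fun i => (dec m).getD i 0) (dec m).length := by
            apply List.ext_getElem <;> simp [pre]
            intro i hi; simp [hi]
          generalize hn : (dec m).length = n at *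
          rw [hl, interleave_pre _ _ hk, interleave_pre _ _ le_rfl]
        simp only [hval, this]
      refine ⟨⟨(dec m).length, fun k hk => ?_⟩, fun k v hv => ?_⟩
      · simp [show (dec m).length ≤ k from hk, key k hk]
      · by_cases hk : (dec m).length ≤ k
        · simp [hk, key k hk] at hv
          exact hv.symm
        · simp [hk] at hv
  · intro p q r hr
    rw [mem_phi_iff]
    intro n
    obtain ⟨⟨k₀, hk₀⟩, hv⟩ := hG _ r hr n
    have hd : ∀ k, dec (Nat.pair n (prefixCode q k)) = pre q k := fun k => by
      simp [hdec, prefixCode_eq]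
    have hvv : ∀ k, val (pre p (dec (Nat.pair n (prefixCode q k))).length)
        (Nat.pair n (prefixCode q k)) =
        Option.casesOn (G (pre (Weihrauch.pairing p q) (2 * k)) n) 0 Nat.succ := fun k => by
      simp only [hval, hd, length_pre, interleave_pre _ _ le_rfl, Nat.unpair_pair]
    simp only [hvv]
    classical
    have hex : ∃ k, G (pre (Weihrauch.pairing p q) (2 * k)) n ≠ none :=
      ⟨k₀, by simp [hk₀ (2 * k₀) (by omega)]⟩
    refine ⟨Nat.find hex, ?_, fun j hj => ?_⟩
    · obtain ⟨v, hv'⟩ := Option.ne_none_iff_exists'.1 (Nat.find_spec hex)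
      simp [hv', hv _ _ hv']
    · have := not_not.1 (Nat.find_min hex hj)
      simp [this]

namespace ComputableFun

lemma exists_name {f : Baire → Baire} (hf : ComputableFun f) :
    ∃ e : Baire, Computable e ∧ ∀ q, f q ∈ phi e q := by
  obtain ⟨e, he, h⟩ := hf
  exact ⟨e, he, fun q => h q _ (Part.mem_some _)⟩

lemma id : ComputableFun fun q => q := ComputablePFun.some_id

lemma const {c : Baire} (hc : Computable c) : ComputableFun fun _ => c := ComputablePFun.const hc

lemma fst {f : Baire → Baire} (hf : ComputableFun f) : ComputableFun fun q => fstB (f q) := by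
  have := ComputablePFun.reindex hf (u := fun n => 2 * n)
    (Primrec.nat_mul.comp (Primrec.const 2) Primrec.id).to_comp
  simp only [Part.map_some] at this
  exact this

lemma snd {f : Baire → Baire} (hf : ComputableFun f) : ComputableFun fun q => sndB (f q) := by
  have := ComputablePFun.reindex hf (u := fun n => 2 * n + 1)
    (Primrec.succ.comp (Primrec.nat_mul.comp (Primrec.const 2) Primrec.id)).to_comp
  simp only [Part.map_some] at this
  exact this

lemma tail {f : Baire → Baire} (hf : ComputableFun f) : ComputableFun fun q => tailB (f q) := by
  have := ComputablePFun.reindex hf (u := fun n => n + 1) Primrec.succ.to_comp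
  simp only [Part.map_some] at this
  exact this

lemma cons (i : ℕ) {f : Baire → Baire} (hf : ComputableFun f) :
    ComputableFun fun q => consB i (f q) := by
  have := ComputablePFun.cons hf i
  simp only [Part.map_some] at this
  exact this

lemma pair {f g : Baire → Baire} (hf : ComputableFun f) (hg : ComputableFun g) :
    ComputableFun fun q => pairing (f q) (g q) := by
  have := ComputablePFun.pairing hf hg
  simp only [Part.map_some, Part.bind_some] at this
  exact this

lemma ite {c f g : Baire → Baire} (hc : ComputableFun c) (hf : ComputableFun f)
    (hg : ComputableFun g) : ComputableFun fun q => if c q 0 = 0 then f q else g q := by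
  have := ComputablePFun.ite hc hf hg
  simp only [Part.bind_some] at this
  unfold ComputableFun
  have h : (fun q => Part.some (if c q 0 = 0 then f q else g q)) =
      fun q => if c q 0 = 0 then Part.some (f q) else Part.some (g q) := by
    funext q
    split_ifs <;> rfl
  rw [h]
  exact this

/-- Currying of a computable function. -/
lemma exists_curry {f : Baire → Baire} (hf : ComputableFun f) :
    ∃ T : Baire → Baire, ComputableFun T ∧ ∀ p q, f (pairing p q) ∈ phi (T p) q := by
  obtain ⟨T, hT, h⟩ := ComputablePFun.exists_curry hf
  exact ⟨T, hT, fun p q => h p q _ (Part.mem_some _)⟩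

/-- Currying of an application of `phi` with computable pre- and postprocessing. -/
lemma exists_curry_phi {A B C : Baire → Baire} (hA : ComputableFun A) (hB : ComputableFun B)
    (hC : ComputableFun C) : ∃ T : Baire → Baire, ComputableFun T ∧ ∀ p q r,
      r ∈ phi (A (pairing p q)) (B (pairing p q)) → C (pairing (pairing p q) r) ∈ phi (T p) q := by
  obtain ⟨c, hc, hcC⟩ := hC.exists_name
  obtain ⟨T, hT, h⟩ := ((ComputablePFun.const hc).app
    (ComputablePFun.some_id.pairing (ComputablePFun.app hA hB))).exists_curry
  refine ⟨T, hT, fun p q r hr => h p q _ ?_⟩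
  simp only [Part.bind_some, Part.mem_bind_iff, Part.mem_map_iff]
  exact ⟨_, ⟨r, hr, rfl⟩, hcC _⟩

end ComputableFun

/-! ## Names of instances and of solutions -/

lemma mem_rep_prodSpace {X : RepSpace.{u}} {Y : RepSpace.{v}} {p : Baire}
    {z : (prodSpace X Y).carrier} :
    z ∈ (prodSpace X Y).rep p ↔ z.1 ∈ X.rep (fstB p) ∧ z.2 ∈ Y.rep (sndB p) := by
  obtain ⟨x, y⟩ := z
  change (x, y) ∈ (X.rep (fstB p)).bind (fun x => (Y.rep (sndB p)).map fun y => (x, y)) ↔ _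
  rw [Part.mem_bind_iff]
  constructor
  · rintro ⟨x', hx, h⟩
    obtain ⟨y', hy, h⟩ := (Part.mem_map_iff _).1 h
    cases h
    exact ⟨hx, hy⟩
  · rintro ⟨h1, h2⟩
    exact ⟨_, h1, (Part.mem_map_iff _).2 ⟨_, h2, rfl⟩⟩

lemma inl_mem_rep_sumSpace {X : RepSpace.{u}} {Y : RepSpace.{v}} {p : Baire} {x : X.carrier} :
    (Sum.inl x : X.carrier ⊕ Y.carrier) ∈ (sumSpace X Y).rep p ↔
      p 0 = 0 ∧ x ∈ X.rep (tailB p) := by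
  change (Sum.inl x : X.carrier ⊕ Y.carrier) ∈
    (if p 0 = 0 then (X.rep (tailB p)).map Sum.inl
      else if p 0 = 1 then (Y.rep (tailB p)).map Sum.inr else Part.none :
      Part (X.carrier ⊕ Y.carrier)) ↔ _
  split_ifs with h h' <;> simp [h]

lemma inr_mem_rep_sumSpace {X : RepSpace.{u}} {Y : RepSpace.{v}} {p : Baire} {y : Y.carrier} :
    (Sum.inr y : X.carrier ⊕ Y.carrier) ∈ (sumSpace X Y).rep p ↔
      p 0 = 1 ∧ y ∈ Y.rep (tailB p) := by
  change (Sum.inr y : X.carrier ⊕ Y.carrier) ∈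
    (if p 0 = 0 then (X.rep (tailB p)).map Sum.inl
      else if p 0 = 1 then (Y.rep (tailB p)).map Sum.inr else Part.none :
      Part (X.carrier ⊕ Y.carrier)) ↔ _
  split_ifs with h h' <;> simp_all

lemma mem_rep_baireSpace {p : Baire} {x : baireSpace.carrier} : x ∈ baireSpace.rep p ↔ x = p :=
  Part.mem_some_iff

lemma mem_rep_mSpace {X : RepSpace.{u}} {Y : RepSpace.{v}} {p : Baire}
    {x : (mSpace X Y).carrier} : x ∈ (mSpace X Y).rep p ↔ x.1 = phiMV X Y p := by
  exact Part.mem_some_iff.trans Subtype.ext_iff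

namespace Problem

/-- `r` is a name of a solution of the instance with name `p`. -/
def sol (f : Problem.{u}) (p r : Baire) : Prop :=
  ∃ x ∈ f.src.rep p, ∃ y ∈ f.tgt.rep r, y ∈ f.map x

/-- `p` is a name of an instance, i.e. of a point of the domain. -/
def inst (f : Problem.{u}) (p : Baire) : Prop := ∃ r, f.sol p r

lemma inst_iff {f : Problem.{u}} {p : Baire} :
    f.inst p ↔ ∃ x ∈ f.src.rep p, x ∈ f.map.dom := by
  constructor
  · rintro ⟨r, x, hx, y, -, hy⟩
    exact ⟨x, hx, y, hy⟩
  · rintro ⟨x, hx, y, hy⟩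
    obtain ⟨r, hr⟩ := f.tgt.surj y
    exact ⟨r, x, hx, y, hr, hy⟩

lemma sol.inst {f : Problem.{u}} {p r : Baire} (h : f.sol p r) : f.inst p := ⟨r, h⟩

lemma inst_iff_of_mem {f : Problem.{u}} {p : Baire} {x : f.src.carrier} (h : x ∈ f.src.rep p) :
    f.inst p ↔ x ∈ f.map.dom := by
  rw [inst_iff]
  constructor
  · rintro ⟨x', hx', h'⟩
    rwa [Part.mem_unique h hx']
  · exact fun h' => ⟨x, h, h'⟩

lemma sol_iff_of_mem {f : Problem.{u}} {p r : Baire} {x : f.src.carrier} {y : f.tgt.carrier}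
    (h : x ∈ f.src.rep p) (hr : y ∈ f.tgt.rep r) : f.sol p r ↔ y ∈ f.map x := by
  constructor
  · rintro ⟨x', hx', y', hy', h'⟩
    rwa [Part.mem_unique h hx', Part.mem_unique hr hy']
  · exact fun h' => ⟨x, h, y, hr, h'⟩

lemma dom_nonempty_iff {f : Problem.{u}} : f.map.dom.Nonempty ↔ ∃ p, f.inst p := by
  constructor
  · rintro ⟨x, hx⟩
    obtain ⟨p, hp⟩ := f.src.surj x
    exact ⟨p, (inst_iff_of_mem hp).2 hx⟩
  · rintro ⟨p, hp⟩
    obtain ⟨x, -, hx⟩ := inst_iff.1 hp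
    exact ⟨x, hx⟩

lemma dom_eq_empty_iff {f : Problem.{u}} : f.map.dom = ∅ ↔ ∀ p, ¬ f.inst p := by
  rw [← Set.not_nonempty_iff_eq_empty, dom_nonempty_iff, not_exists]

/-- A reduction is given by computable transformations of the names of instances and solutions. -/
lemma Reduces.of_fun {f g : Problem.{u}} {H K : Baire → Baire} (hH : ComputableFun H)
    (hK : ComputableFun K) (h : ∀ p, f.inst p →
      g.inst (H p) ∧ ∀ r, g.sol (H p) r → f.sol p (K (pairing p r))) : f.Reduces g := by
  refine ⟨_, _, hK, hH, fun G hG p x hx hd => ?_⟩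
  obtain ⟨h1, h2⟩ := h p ((inst_iff_of_mem hx).2 hd)
  obtain ⟨x', hx', hd'⟩ := inst_iff.1 h1
  obtain ⟨r, hr, y, hy, hyx⟩ := hG _ x' hx' hd'
  obtain ⟨x'', hx'', y'', hy'', h''⟩ := h2 r ⟨x', hx', y, hy, hyx⟩
  refine ⟨_, ?_, y'', hy'', by rwa [Part.mem_unique hx hx'']⟩
  simp only [wrap, Part.bind_some, Part.mem_bind_iff]
  exact ⟨r, hr, Part.mem_some _⟩

/-- Realizers that answer `r` wherever `r` is a solution turn the quantifier over realizers into one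
over solutions. Since `H` is single-valued, one `h` serves all `r`. -/
lemma Reduces.exists_fun {f g : Problem.{u}} (h : f.Reduces g) :
    ∃ K H : Baire →. Baire, ComputablePFun K ∧ ComputablePFun H ∧ ∀ p, f.inst p →
      ∃ h ∈ H p, g.inst h ∧ ∀ r, g.sol h r → ∃ k ∈ K (pairing p r), f.sol p k := by
  classical
  obtain ⟨K, H, hK, hH, h⟩ := h
  refine ⟨K, H, hK, hH, fun p hp => ?_⟩
  obtain ⟨x, hx, hd⟩ := inst_iff.1 hp
  have key : ∀ r, ∃ h ∈ H p, g.inst h ∧ (g.sol h r → ∃ k ∈ K (pairing p r), f.sol p k) := by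
    intro r
    -- `G` is undefined off the names of instances, so its being applied certifies that `H` produced
    -- an instance.
    set G : Baire →. Baire := fun h =>
      ⟨g.inst h, fun hh => if g.sol h r then r else Classical.choose hh⟩ with hG
    have hG' : Realizes G g := by
      intro h x' hx' hd'
      have hi : g.inst h := (inst_iff_of_mem hx').2 hd'
      have hs : g.sol h (if g.sol h r then r else Classical.choose hi) := by
        split_ifs with hr
        · exact hr
        · exact Classical.choose_spec hi
      obtain ⟨x'', hx'', y, hy, hyx⟩ := hs
      exact ⟨_, ⟨hi, rfl⟩, y, hy, by rwa [Part.mem_unique hx' hx'']⟩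
    obtain ⟨k, hk, y, hy, hyx⟩ := h G hG' p x hx hd
    simp only [wrap, Part.mem_bind_iff] at hk
    obtain ⟨h, hh, r', ⟨hi, rfl⟩, hk⟩ := hk
    refine ⟨h, hh, hi, fun hr => ⟨k, ?_, x, hx, y, hy, hyx⟩⟩
    simpa [hG, hr] using hk
  obtain ⟨h, hh, hi, -⟩ := key p
  refine ⟨h, hh, hi, fun r hr => ?_⟩
  obtain ⟨h', hh', -, hr'⟩ := key r
  rw [Part.mem_unique hh' hh] at hr'
  exact hr' hr

lemma not_inst_zero (p : Baire) : ¬ zero.{u}.inst p := by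
  rintro ⟨r, x, hx, y, hy, h⟩
  exact h

lemma sol_sup {f g : Problem.{u}} {p r : Baire} : (f.sup g).sol p r ↔
    (p 0 = 0 ∧ r 0 = 0 ∧ f.sol (tailB p) (tailB r)) ∨
    (p 0 = 1 ∧ r 0 = 1 ∧ g.sol (tailB p) (tailB r)) := by
  constructor
  · rintro ⟨x | x, hx, y, hy, h⟩
    · obtain ⟨y, h, rfl⟩ := h
      replace hx := inl_mem_rep_sumSpace.1 hx
      replace hy := inl_mem_rep_sumSpace.1 hy
      exact Or.inl ⟨hx.1, hy.1, x, hx.2, y, hy.2, h⟩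
    · obtain ⟨y, h, rfl⟩ := h
      replace hx := inr_mem_rep_sumSpace.1 hx
      replace hy := inr_mem_rep_sumSpace.1 hy
      exact Or.inr ⟨hx.1, hy.1, x, hx.2, y, hy.2, h⟩
  · rintro (⟨hp, hr, x, hx, y, hy, h⟩ | ⟨hp, hr, x, hx, y, hy, h⟩)
    · exact ⟨Sum.inl x, inl_mem_rep_sumSpace.2 ⟨hp, hx⟩, Sum.inl y,
        inl_mem_rep_sumSpace.2 ⟨hr, hy⟩, y, h, rfl⟩
    · exact ⟨Sum.inr x, inr_mem_rep_sumSpace.2 ⟨hp, hx⟩, Sum.inr y,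
        inr_mem_rep_sumSpace.2 ⟨hr, hy⟩, y, h, rfl⟩

@[simp] lemma consB_zero (i : ℕ) (p : Baire) : consB i p 0 = i := rfl

attribute [simp] fstB_pairing sndB_pairing tailB_consB

lemma inst_sup {f g : Problem.{u}} {p : Baire} : (f.sup g).inst p ↔
    (p 0 = 0 ∧ f.inst (tailB p)) ∨ (p 0 = 1 ∧ g.inst (tailB p)) := by
  constructor
  · rintro ⟨r, h⟩
    rcases sol_sup.1 h with ⟨h1, -, h2⟩ | ⟨h1, -, h2⟩
    · exact Or.inl ⟨h1, _, h2⟩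
    · exact Or.inr ⟨h1, _, h2⟩
  · rintro (⟨h, r, hr⟩ | ⟨h, r, hr⟩)
    · exact ⟨consB 0 r, sol_sup.2 (by simp [h, hr])⟩
    · exact ⟨consB 1 r, sol_sup.2 (by simp [h, hr])⟩

lemma sol_times {f g : Problem.{u}} {p r : Baire} : (f.times g).sol p r ↔
    f.sol (fstB p) (fstB r) ∧ g.sol (sndB p) (sndB r) := by
  constructor
  · rintro ⟨x, hx, y, hy, h⟩
    replace hx := mem_rep_prodSpace.1 hx
    replace hy := mem_rep_prodSpace.1 hy
    exact ⟨⟨_, hx.1, _, hy.1, h.1⟩, ⟨_, hx.2, _, hy.2, h.2⟩⟩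
  · rintro ⟨⟨x, hx, y, hy, h⟩, ⟨x', hx', y', hy', h'⟩⟩
    exact ⟨(x, x'), mem_rep_prodSpace.2 ⟨hx, hx'⟩, (y, y'), mem_rep_prodSpace.2 ⟨hy, hy'⟩, h, h'⟩

lemma inst_times {f g : Problem.{u}} {p : Baire} : (f.times g).inst p ↔
    f.inst (fstB p) ∧ g.inst (sndB p) := by
  constructor
  · rintro ⟨r, h⟩
    exact ⟨(sol_times.1 h).1.inst, (sol_times.1 h).2.inst⟩
  · rintro ⟨⟨r, hr⟩, ⟨s, hs⟩⟩
    exact ⟨pairing r s, sol_times.2 (by simp [hr, hs])⟩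

lemma sol_inf {f g : Problem.{u}} {p r : Baire} : (f.inf g).sol p r ↔
    f.inst (fstB p) ∧ g.inst (sndB p) ∧ ((r 0 = 0 ∧ f.sol (fstB p) (tailB r)) ∨
      (r 0 = 1 ∧ g.sol (sndB p) (tailB r))) := by
  constructor
  · rintro ⟨x, hx, y, hy, h1, h2, h⟩
    replace hx := mem_rep_prodSpace.1 hx
    refine ⟨(inst_iff_of_mem hx.1).2 h1, (inst_iff_of_mem hx.2).2 h2, ?_⟩
    rcases h with ⟨y, h, rfl⟩ | ⟨y, h, rfl⟩
    · obtain ⟨hr, hy⟩ := inl_mem_rep_sumSpace.1 hy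
      exact Or.inl ⟨hr, _, hx.1, y, hy, h⟩
    · obtain ⟨hr, hy⟩ := inr_mem_rep_sumSpace.1 hy
      exact Or.inr ⟨hr, _, hx.2, y, hy, h⟩
  · rintro ⟨h1, h2, h⟩
    obtain ⟨x, hx, hd⟩ := inst_iff.1 h1
    obtain ⟨x', hx', hd'⟩ := inst_iff.1 h2
    refine ⟨(x, x'), mem_rep_prodSpace.2 ⟨hx, hx'⟩, ?_⟩
    rcases h with ⟨hr, x₁, hx₁, y, hy, h⟩ | ⟨hr, x₁, hx₁, y, hy, h⟩
    · cases Part.mem_unique hx hx₁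
      exact ⟨Sum.inl y, inl_mem_rep_sumSpace.2 ⟨hr, hy⟩, hd, hd', Or.inl ⟨y, h, rfl⟩⟩
    · cases Part.mem_unique hx' hx₁
      exact ⟨Sum.inr y, inr_mem_rep_sumSpace.2 ⟨hr, hy⟩, hd, hd', Or.inr ⟨y, h, rfl⟩⟩

lemma inst_inf {f g : Problem.{u}} {p : Baire} : (f.inf g).inst p ↔
    f.inst (fstB p) ∧ g.inst (sndB p) := by
  constructor
  · rintro ⟨r, h⟩
    exact ⟨(sol_inf.1 h).1, (sol_inf.1 h).2.1⟩
  · rintro ⟨⟨r, hr⟩, h⟩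
    exact ⟨consB 0 r, sol_inf.2 ⟨⟨r, hr⟩, h, Or.inl (by simp [hr])⟩⟩

/-- The values of `H ∘ g`, in terms of names. -/
lemma mem_dom_comp_iff {g : Problem.{u}} {U : RepSpace.{u}} {k q : Baire} {x : g.src.carrier}
    (hx : x ∈ g.src.rep q) : x ∈ (MV.comp (phiMV g.tgt U k) g.map).dom ↔
      g.inst q ∧ ∀ s, g.sol q (fstB s) → ∃ w ∈ phi k s, (U.rep w).Dom := by
  constructor
  · rintro ⟨u, h, y, hy, hu⟩
    refine ⟨(inst_iff_of_mem hx).2 ⟨y, hy⟩, fun s hs => ?_⟩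
    obtain ⟨x', hx', y', hy', h'⟩ := hs
    cases Part.mem_unique hx hx'
    obtain ⟨u', h1, -⟩ := h h'
    exact h1 s hy'
  · rintro ⟨⟨r, hr⟩, h⟩
    have hd : g.map x ⊆ (phiMV g.tgt U k).dom := by
      intro y hy
      obtain ⟨r, hr⟩ := g.tgt.surj y
      have hs : ∀ s, y ∈ g.tgt.rep (fstB s) → ∃ w ∈ phi k s, (U.rep w).Dom := fun s hs =>
        h s ⟨x, hx, y, hs, hy⟩
      -- Any second component would do: the cylindrified representation ignores it.
      obtain ⟨w, hw, hwd⟩ := hs (pairing r r) (by simpa using hr)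
      exact ⟨_, hs, pairing r r, by simpa [cylRep] using hr, w, hw, Part.get_mem hwd⟩
    obtain ⟨x', hx', y, hy, hyx⟩ := hr
    cases Part.mem_unique hx hx'
    obtain ⟨u, hu⟩ := hd hyx
    exact ⟨u, hd, y, hyx, hu⟩

lemma mem_comp_iff {g : Problem.{u}} {U : RepSpace.{u}} {k q : Baire} {x : g.src.carrier}
    (hx : x ∈ g.src.rep q) {u : U.carrier} : u ∈ MV.comp (phiMV g.tgt U k) g.map x ↔
      x ∈ (MV.comp (phiMV g.tgt U k) g.map).dom ∧
      ∃ s, g.sol q (fstB s) ∧ ∃ w ∈ phi k s, u ∈ U.rep w := by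
  constructor
  · intro h
    refine ⟨⟨u, h⟩, ?_⟩
    obtain ⟨-, y, hy, -, s, hs, w, hw, hu⟩ := h
    exact ⟨s, ⟨x, hx, y, hs, hy⟩, w, hw, hu⟩
  · rintro ⟨⟨u', hd, -⟩, s, ⟨x', hx', y, hy, hyx⟩, w, hw, hu⟩
    cases Part.mem_unique hx hx'
    exact ⟨hd, y, hyx, (hd hyx).choose_spec.1, s, hy, w, hw, hu⟩

/-- The instances of `f ⋆ g`, in terms of names. -/
lemma mem_dom_star_iff {f g : Problem.{u}} {p : Baire} {x : (f.star g).src.carrier}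
    (hx : x ∈ (f.star g).src.rep p) : x ∈ (f.star g).map.dom ↔
      g.inst (sndB p) ∧ ∀ s, g.sol (sndB p) (fstB s) → ∃ w ∈ phi (fstB p) s, f.inst (sndB w) := by
  obtain ⟨⟨h, hh⟩, x⟩ := x
  obtain ⟨h1, h2⟩ := mem_rep_prodSpace.1 hx
  replace h1 := mem_rep_mSpace.1 h1
  dsimp only at h1 h2
  subst h1
  have ht : ∀ u, u ∈ transpose g (prodSpace baireSpace f.src) (⟨_, hh⟩, x) ↔ _ := fun u =>
    mem_comp_iff (U := prodSpace baireSpace f.src) h2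
  have hi : ∀ w u, u ∈ (prodSpace baireSpace f.src).rep w →
      (u ∈ (idTimes f).dom ↔ f.inst (sndB w)) := by
    intro w u hu
    rw [mem_rep_prodSpace] at hu
    rw [inst_iff_of_mem hu.2]
    constructor
    · rintro ⟨z, hz⟩
      exact ⟨z.2, hz.2⟩
    · rintro ⟨z, hz⟩
      exact ⟨(u.1, z), rfl, hz⟩
  constructor
  · rintro ⟨z, hz1, u, hu, hz⟩
    obtain ⟨hd1, hd2⟩ := (mem_dom_comp_iff h2).1 ((ht u).1 hu).1
    refine ⟨hd1, fun s hs => ?_⟩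
    obtain ⟨w, hw, hwd⟩ := hd2 s hs
    refine ⟨w, hw, (hi w _ (Part.get_mem hwd)).1 (hz1 ?_)⟩
    exact (ht _).2 ⟨((ht u).1 hu).1, s, hs, w, hw, Part.get_mem hwd⟩
  · rintro ⟨hd1, hd2⟩
    have hw : ∀ w, f.inst (sndB w) → ((prodSpace baireSpace f.src).rep w).Dom := by
      intro w hw
      obtain ⟨v, hv, -⟩ := inst_iff.1 hw
      exact (mem_rep_prodSpace (X := baireSpace) (z := (fstB w, v)).2
        ⟨mem_rep_baireSpace.2 rfl, hv⟩).1
    have hd : x ∈ (MV.comp (phiMV g.tgt (prodSpace baireSpace f.src) (fstB p)) g.map).dom := by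
      refine (mem_dom_comp_iff h2).2 ⟨hd1, fun s hs => ?_⟩
      obtain ⟨w, hw', hwi⟩ := hd2 s hs
      exact ⟨w, hw', hw w hwi⟩
    have hsub : transpose g (prodSpace baireSpace f.src) (⟨_, hh⟩, x) ⊆ (idTimes f).dom := by
      intro u hu
      obtain ⟨-, s, hs, w, hw, hu⟩ := (ht u).1 hu
      obtain ⟨w', hw', hwi⟩ := hd2 s hs
      cases Part.mem_unique hw hw'
      exact (hi w u hu).2 hwi
    obtain ⟨u, hu⟩ := hd
    obtain ⟨z, hz⟩ := hsub hu
    exact ⟨z, hsub, u, hu, hz⟩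

/-- Programs act on cylindrified names `s`: only `fstB s` is a solution, but the program may see the
rest and must succeed for all of it. In its output `w`, the part `sndB w` is the next instance and
`fstB w` is passed on. -/
lemma inst_star {f g : Problem.{u}} {p : Baire} : (f.star g).inst p ↔
    g.inst (sndB p) ∧
      ∀ s, g.sol (sndB p) (fstB s) → ∃ w ∈ phi (fstB p) s, f.inst (sndB w) := by
  constructor
  · intro h
    obtain ⟨x, hx, hd⟩ := inst_iff.1 h
    exact (mem_dom_star_iff hx).1 hd
  · intro h
    obtain ⟨v, hv, -⟩ := inst_iff.1 h.1
    have hx : ((⟨_, _, rfl⟩, v) : (f.star g).src.carrier) ∈ (f.star g).src.rep p :=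
      mem_rep_prodSpace.2 ⟨mem_rep_mSpace.2 rfl, hv⟩
    exact (inst_iff_of_mem hx).2 ((mem_dom_star_iff hx).2 h)

lemma sol_star {f g : Problem.{u}} {p r : Baire} : (f.star g).sol p r ↔
    (f.star g).inst p ∧ ∃ s, g.sol (sndB p) (fstB s) ∧ ∃ w ∈ phi (fstB p) s,
      fstB r = fstB w ∧ f.sol (sndB w) (sndB r) := by
  constructor
  · intro h
    refine ⟨h.inst, ?_⟩
    obtain ⟨⟨⟨h, hh⟩, x⟩, hx, z, hz, -, u, hu, hzu⟩ := h
    obtain ⟨h1, h2⟩ := mem_rep_prodSpace.1 hx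
    replace h1 := mem_rep_mSpace.1 h1
    obtain ⟨hz1, hz2⟩ := mem_rep_prodSpace.1 hz
    replace hz1 := mem_rep_baireSpace.1 hz1
    dsimp only at h1 h2
    subst h1
    obtain ⟨-, s, hs, w, hw, hu⟩ := (mem_comp_iff h2).1 hu
    obtain ⟨hu1, hu2⟩ := mem_rep_prodSpace.1 hu
    replace hu1 := mem_rep_baireSpace.1 hu1
    refine ⟨s, hs, w, hw, ?_, _, hu2, _, hz2, hzu.2⟩
    rw [← hu1, ← hz1]
    exact hzu.1
  · rintro ⟨hi, s, hs, w, hw, hrw, v, hv, y, hy, hyv⟩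
    obtain ⟨⟨⟨h, hh⟩, x⟩, hx, hd⟩ := inst_iff.1 hi
    obtain ⟨h1, h2⟩ := mem_rep_prodSpace.1 hx
    replace h1 := mem_rep_mSpace.1 h1
    dsimp only at h1 h2
    subst h1
    obtain ⟨z, hz, u, hu, -⟩ := hd
    refine ⟨_, hx, (fstB r, y), mem_rep_prodSpace.2 ⟨mem_rep_baireSpace.2 rfl, hy⟩, hz,
      (fstB w, v), ?_, hrw, hyv⟩
    exact (mem_comp_iff h2).2 ⟨((mem_comp_iff h2).1 hu).1, s, hs, w, hw,
      mem_rep_prodSpace.2 ⟨mem_rep_baireSpace.2 rfl, hv⟩⟩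

lemma sol_impl {g f : Problem.{u}} {p r : Baire} : (g.impl f).sol p r ↔
    f.inst p ∧ g.inst (sndB r) ∧
      ∀ s, g.sol (sndB r) (fstB s) → ∃ w ∈ phi (fstB r) s, f.sol p w := by
  constructor
  · rintro ⟨x, hx, ⟨⟨H, hH⟩, v⟩, hy, h1, h2, h3⟩
    obtain ⟨h4, h5⟩ := mem_rep_prodSpace.1 hy
    replace h4 := mem_rep_mSpace.1 h4
    dsimp only at h4 h5
    subst h4
    obtain ⟨h6, h7⟩ := (mem_dom_comp_iff h5).1 h2
    refine ⟨(inst_iff_of_mem (f := f) hx).2 h1, h6, fun s hs => ?_⟩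
    obtain ⟨w, hw, hwd⟩ := h7 s hs
    exact ⟨w, hw, x, hx, _, Part.get_mem hwd,
      h3 ((mem_comp_iff h5).2 ⟨h2, s, hs, w, hw, Part.get_mem hwd⟩)⟩
  · rintro ⟨h1, h2, h3⟩
    obtain ⟨x, hx, hd⟩ := inst_iff.1 h1
    obtain ⟨v, hv, -⟩ := inst_iff.1 h2
    have hdom : v ∈ (MV.comp (phiMV g.tgt f.tgt (fstB r)) g.map).dom := by
      refine (mem_dom_comp_iff hv).2 ⟨h2, fun s hs => ?_⟩
      obtain ⟨w, hw, x', -, y, hy, -⟩ := h3 s hs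
      exact ⟨w, hw, hy.1⟩
    refine ⟨x, hx, (⟨_, _, rfl⟩, v), mem_rep_prodSpace.2 ⟨mem_rep_mSpace.2 rfl, hv⟩, hd, hdom, ?_⟩
    intro y hy
    obtain ⟨-, s, hs, w, hw, hyw⟩ := (mem_comp_iff hv).1 hy
    obtain ⟨w', hw', hsol⟩ := h3 s hs
    cases Part.mem_unique hw hw'
    exact (sol_iff_of_mem hx hyw).1 hsol

/-- A name of a constant function. -/
lemma exists_phi_const (c : Baire) : ∃ e, ∀ q, c ∈ phi e q := by
  refine ⟨fun m => c m.unpair.1 + 1, fun q => mem_phi_iff.2 fun n => ⟨0, ?_, ?_⟩⟩ <;> simp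

/-- A constant program that outputs a fixed solution works with any instance of `g`; it need not be
computable to be a solution. -/
lemma inst_impl {g f : Problem.{u}} {p : Baire} : (g.impl f).inst p ↔
    f.inst p ∧ ∃ q, g.inst q := by
  constructor
  · rintro ⟨r, h⟩
    exact ⟨(sol_impl.1 h).1, _, (sol_impl.1 h).2.1⟩
  · rintro ⟨⟨r, hr⟩, q, hq⟩
    obtain ⟨e, he⟩ := exists_phi_const r
    exact ⟨pairing e q, sol_impl.2 ⟨⟨r, hr⟩, by simpa using hq, fun s _ =>
      ⟨r, by simpa using he s, hr⟩⟩⟩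

end Problem

/-- `r` with the tag of `c`. -/
def tag (c r : Baire) : Baire := if c 0 = 0 then consB 0 r else consB 1 r

@[simp] lemma tailB_tag (c r : Baire) : tailB (tag c r) = r := by
  unfold tag
  split_ifs <;> simp

@[simp] lemma tag_zero_eq_zero {c r : Baire} : tag c r 0 = 0 ↔ c 0 = 0 := by
  unfold tag
  split_ifs with h <;> simp [h]

@[simp] lemma tag_zero_eq_one {c r : Baire} : tag c r 0 = 1 ↔ ¬ c 0 = 0 := by
  unfold tag
  split_ifs with h <;> simp [h]

namespace ComputableFun

lemma tag {f g : Baire → Baire} (hf : ComputableFun f) (hg : ComputableFun g) :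
    ComputableFun fun q => Weihrauch.tag (f q) (g q) := hf.ite (hg.cons 0) (hg.cons 1)

lemma comp {f g : Baire → Baire} (hf : ComputableFun f) (hg : ComputableFun g) :
    ComputableFun fun q => f (g q) := by
  obtain ⟨e, he, h⟩ := hf.exists_name
  have := (ComputablePFun.const he).app hg
  simp only [Part.bind_some] at this
  have h' : (fun q => Part.some (f (g q))) = fun q => phi e (g q) :=
    funext fun q => (Part.eq_some_iff.2 (h _)).symm
  unfold ComputableFun
  rw [h']
  exact this

end ComputableFun

/-! ### Reductions by total computable functions, and monotonicity -/

namespace Problem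

open ComputableFun

variable {a b c d f g : Problem.{u}}

/-- Reducibility with total computable functions. -/
def TotReduces (f g : Problem.{u}) : Prop :=
  ∃ H K : Baire → Baire, ComputableFun H ∧ ComputableFun K ∧ ∀ p, f.inst p →
    g.inst (H p) ∧ ∀ r, g.sol (H p) r → f.sol p (K (pairing p r))

lemma TotReduces.reduces (h : f.TotReduces g) : f.Reduces g := by
  obtain ⟨H, K, hH, hK, h⟩ := h
  exact .of_fun hH hK h

namespace TotReduces

lemma refl (a : Problem.{u}) : a.TotReduces a :=
  ⟨fun p => p, sndB, id, id.snd, fun p hp => ⟨hp, fun r hr => by simpa using hr⟩⟩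

lemma of_not_inst (h : ∀ p, ¬ a.inst p) : a.TotReduces b :=
  ⟨fun p => p, fun p => p, id, id, fun p hp => (h p hp).elim⟩

lemma trans (h₁ : a.TotReduces b) (h₂ : b.TotReduces c) : a.TotReduces c := by
  obtain ⟨H, K, hH, hK, h⟩ := h₁
  obtain ⟨H', K', hH', hK', h'⟩ := h₂
  refine ⟨fun p => H' (H p), fun z => K (pairing (fstB z) (K' (pairing (H (fstB z)) (sndB z)))),
    hH'.comp hH, hK.comp (id.fst.pair (hK'.comp ((hH.comp id.fst).pair id.snd))), fun p hp => ?_⟩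
  obtain ⟨h1, h2⟩ := h p hp
  obtain ⟨h3, h4⟩ := h' _ h1
  exact ⟨h3, fun r hr => by simpa using h2 _ (h4 r hr)⟩

lemma sup_left (a b : Problem.{u}) : a.TotReduces (a.sup b) := by
  refine ⟨consB 0, fun z => tailB (sndB z), id.cons 0, id.snd.tail, fun p hp => ?_⟩
  simp +contextual [inst_sup, sol_sup, hp]

lemma sup_right (a b : Problem.{u}) : b.TotReduces (a.sup b) := by
  refine ⟨consB 1, fun z => tailB (sndB z), id.cons 1, id.snd.tail, fun p hp => ?_⟩
  simp +contextual [inst_sup, sol_sup, hp]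

lemma sup_le (h₁ : a.TotReduces c) (h₂ : b.TotReduces c) : (a.sup b).TotReduces c := by
  obtain ⟨H, K, hH, hK, h⟩ := h₁
  obtain ⟨H', K', hH', hK', h'⟩ := h₂
  refine ⟨fun p => if p 0 = 0 then H (tailB p) else H' (tailB p),
    fun z => if fstB z 0 = 0 then consB 0 (K (pairing (tailB (fstB z)) (sndB z)))
      else consB 1 (K' (pairing (tailB (fstB z)) (sndB z))),
    id.ite (hH.comp id.tail) (hH'.comp id.tail),
    id.fst.ite ((hK.comp (id.fst.tail.pair id.snd)).cons 0)
      ((hK'.comp (id.fst.tail.pair id.snd)).cons 1), fun p hp => ?_⟩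
  rcases inst_sup.1 hp with ⟨h0, hp⟩ | ⟨h1, hp⟩
  · simpa [h0, sol_sup] using h _ hp
  · simpa [h1, sol_sup] using h' _ hp

lemma inf_left (a b : Problem.{u}) : (a.inf b).TotReduces a := by
  refine ⟨fstB, fun z => consB 0 (sndB z), id.fst, id.snd.cons 0, fun p hp => ?_⟩
  have hp' := inst_inf.1 hp
  exact ⟨hp'.1, fun r hr => sol_inf.2 ⟨hp'.1, hp'.2, Or.inl ⟨rfl, by simpa using hr⟩⟩⟩

lemma inf_right (a b : Problem.{u}) : (a.inf b).TotReduces b := by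
  refine ⟨sndB, fun z => consB 1 (sndB z), id.snd, id.snd.cons 1, fun p hp => ?_⟩
  have hp' := inst_inf.1 hp
  exact ⟨hp'.2, fun r hr => sol_inf.2 ⟨hp'.1, hp'.2, Or.inr ⟨rfl, by simpa using hr⟩⟩⟩

lemma le_inf (h₁ : a.TotReduces b) (h₂ : a.TotReduces c) : a.TotReduces (b.inf c) := by
  obtain ⟨H, K, hH, hK, h⟩ := h₁
  obtain ⟨H', K', hH', hK', h'⟩ := h₂
  refine ⟨fun p => pairing (H p) (H' p),
    fun z => if sndB z 0 = 0 then K (pairing (fstB z) (tailB (sndB z)))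
      else K' (pairing (fstB z) (tailB (sndB z))),
    hH.pair hH', id.snd.ite (hK.comp (id.fst.pair id.snd.tail))
      (hK'.comp (id.fst.pair id.snd.tail)), fun p hp => ⟨?_, fun r hr => ?_⟩⟩
  · simpa [inst_inf] using ⟨(h p hp).1, (h' p hp).1⟩
  · obtain ⟨-, -, ⟨h0, hr⟩ | ⟨h1, hr⟩⟩ := sol_inf.1 hr
    · simpa [h0] using (h p hp).2 _ (by simpa using hr)
    · simpa [h1] using (h' p hp).2 _ (by simpa using hr)

lemma times_mono (h₁ : a.TotReduces c) (h₂ : b.TotReduces d) :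
    (a.times b).TotReduces (c.times d) := by
  obtain ⟨H, K, hH, hK, h⟩ := h₁
  obtain ⟨H', K', hH', hK', h'⟩ := h₂
  refine ⟨fun p => pairing (H (fstB p)) (H' (sndB p)),
    fun z => pairing (K (pairing (fstB (fstB z)) (fstB (sndB z))))
      (K' (pairing (sndB (fstB z)) (sndB (sndB z)))),
    (hH.comp id.fst).pair (hH'.comp id.snd),
    (hK.comp (id.fst.fst.pair id.snd.fst)).pair (hK'.comp (id.fst.snd.pair id.snd.snd)),
    fun p hp => ?_⟩
  obtain ⟨h1, h2⟩ := inst_times.1 hp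
  exact ⟨by simpa [inst_times] using ⟨(h _ h1).1, (h' _ h2).1⟩, fun r hr => by
    simp only [sol_times, fstB_pairing, sndB_pairing] at hr ⊢
    exact ⟨(h _ h1).2 _ hr.1, (h' _ h2).2 _ hr.2⟩⟩

end TotReduces

/-- An instance of `f ⋆ g` and its solutions, from a description of the values of the first
argument. -/
lemma star_intro {e q : Baire} {P : Baire → Baire → Prop} (hq : g.inst q)
    (h : ∀ s, g.sol q (fstB s) → ∃ v ∈ phi e s, f.inst (sndB v) ∧ P s v) :
    (f.star g).inst (pairing e q) ∧ ∀ r, (f.star g).sol (pairing e q) r →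
      ∃ s v, g.sol q (fstB s) ∧ P s v ∧ fstB r = fstB v ∧ f.sol (sndB v) (sndB r) := by
  constructor
  · rw [inst_star, fstB_pairing, sndB_pairing]
    refine ⟨hq, fun s hs => ?_⟩
    obtain ⟨v, hv, hi, -⟩ := h s hs
    exact ⟨v, hv, hi⟩
  · intro r hr
    obtain ⟨-, s, hs, w, hw, h1, h2⟩ := sol_star.1 hr
    rw [fstB_pairing] at hw
    rw [sndB_pairing] at hs
    obtain ⟨v, hv, -, hP⟩ := h s hs
    cases Part.mem_unique hw hv
    exact ⟨s, w, hs, hP, h1, h2⟩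

namespace TotReduces

/-- The new program translates the answer back by `K'`, runs the old program to get `w`, and
translates the next instance by `H`. It passes on all of `w`, because `K` later needs the original
instance `sndB w`. -/
lemma star_mono (h₁ : a.TotReduces c) (h₂ : b.TotReduces d) :
    (a.star b).TotReduces (c.star d) := by
  obtain ⟨H, K, hH, hK, h⟩ := h₁
  obtain ⟨H', K', hH', hK', h'⟩ := h₂
  obtain ⟨T, hT, hTe⟩ := exists_curry_phi id.fst.fst
    ((hK'.comp (id.fst.snd.pair id.snd.fst)).pair id.snd.snd) (id.snd.pair (hH.comp id.snd.snd))
  simp only [fstB_pairing, sndB_pairing] at hTe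
  refine ⟨fun p => pairing (T p) (H' (sndB p)), fun z => pairing (fstB (fstB (sndB z)))
    (K (pairing (sndB (fstB (sndB z))) (sndB (sndB z)))), hT.pair (hH'.comp id.snd),
    id.snd.fst.fst.pair (hK.comp (id.snd.fst.snd.pair id.snd.snd)), fun p hp => ?_⟩
  obtain ⟨hq, hp'⟩ := inst_star.1 hp
  obtain ⟨h1, h2⟩ := h' _ hq
  obtain ⟨h3, h4⟩ := star_intro (f := c) (e := T p) (P := fun s v => ∃ w ∈ phi (fstB p)
    (pairing (K' (pairing (sndB p) (fstB s))) (sndB s)), v = pairing w (H (sndB w)) ∧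
      a.inst (sndB w)) h1 fun s hs => by
    obtain ⟨w, hw, hi⟩ := hp' (pairing (K' (pairing (sndB p) (fstB s))) (sndB s))
      (by simpa using h2 _ hs)
    exact ⟨_, hTe _ _ _ hw, by simpa using (h _ hi).1, w, hw, rfl, hi⟩
  refine ⟨h3, fun r hr => ?_⟩
  obtain ⟨s, -, hs, ⟨w, hw, rfl, hi⟩, h5, h6⟩ := h4 r hr
  rw [fstB_pairing] at h5
  rw [sndB_pairing] at h6
  exact sol_star.2 ⟨hp, _, by simpa using h2 _ hs, w, hw, by simp [h5], by
    simpa [h5] using (h _ hi).2 _ h6⟩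

lemma impl_mono (h : b.TotReduces c) : (a.impl b).TotReduces (a.impl c) := by
  obtain ⟨H, K, hH, hK, h⟩ := h
  obtain ⟨T, hT, hTe⟩ := exists_curry_phi id.fst.snd.fst id.snd
    (hK.comp (id.fst.fst.fst.pair id.snd))
  simp only [fstB_pairing, sndB_pairing] at hTe
  refine ⟨H, fun z => pairing (T z) (sndB (sndB z)), hH, hT.pair id.snd.snd, fun p hp => ?_⟩
  obtain ⟨hp, ha⟩ := inst_impl.1 hp
  refine ⟨inst_impl.2 ⟨(h p hp).1, ha⟩, fun r hr => ?_⟩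
  obtain ⟨-, h1, h2⟩ := sol_impl.1 hr
  refine sol_impl.2 ⟨hp, by simpa using h1, fun s hs => ?_⟩
  obtain ⟨w, hw, hs⟩ := h2 s (by simpa using hs)
  exact ⟨_, by simpa using hTe (pairing p r) s w (by simpa using hw), (h p hp).2 _ hs⟩

lemma times_self (a : Problem.{u}) : a.TotReduces (a.times a) :=
  ⟨fun p => pairing p p, fun z => fstB (sndB z), id.pair id, id.snd.fst,
    fun p hp => ⟨inst_times.2 (by simpa using hp), fun r hr => by simpa using (sol_times.1 hr).1⟩⟩

/-- The program ignores the first answer and presents the same instance again. -/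
lemma star_self (a : Problem.{u}) : a.TotReduces (a.star a) := by
  obtain ⟨T, hT, hTe⟩ := exists_curry (id.snd.pair id.fst)
  simp only [fstB_pairing, sndB_pairing] at hTe
  refine ⟨fun p => pairing (T p) p, fun z => sndB (sndB z), hT.pair id, id.snd.snd,
    fun p hp => ?_⟩
  obtain ⟨h1, h2⟩ := star_intro (f := a) (e := T p) (P := fun s v => v = pairing s p) hp
    fun s _ => ⟨_, hTe _ _, by simpa using hp, rfl⟩
  refine ⟨h1, fun r hr => ?_⟩
  obtain ⟨s, -, -, rfl, -, h⟩ := h2 r hr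
  simpa using h

end TotReduces

open TotReduces

/-! ### The distributivity reductions for multi-valued functions -/

lemma times_sup_reduces : (a.times (b.sup c)).TotReduces ((a.times b).sup (a.times c)) := by
  refine ⟨fun p => tag (sndB p) (pairing (fstB p) (tailB (sndB p))),
    fun z => pairing (fstB (tailB (sndB z))) (tag (sndB z) (sndB (tailB (sndB z)))),
    id.snd.tag (id.fst.pair id.snd.tail),
    id.snd.tail.fst.pair (id.snd.tag id.snd.tail.snd), fun p hp => ?_⟩
  simp only [inst_times, inst_sup] at hp
  obtain ⟨ha, ⟨h0, h⟩ | ⟨h1, h⟩⟩ := hp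
  · simp +contextual [inst_times, inst_sup, sol_sup, sol_times, *]
  · simp +contextual [inst_times, inst_sup, sol_sup, sol_times, *]

lemma sup_times_reduces : ((a.times b).sup (a.times c)).TotReduces (a.times (b.sup c)) :=
  sup_le (times_mono (.refl a) (sup_left b c)) (times_mono (.refl a) (sup_right b c))

/-- The tag of the instance of `b ⊔ c` is visible before any question is asked, so the summand can
be chosen at once. The program then restores the tag on the answer before running the old one. -/
lemma star_sup_reduces : (a.star (b.sup c)).TotReduces ((a.star b).sup (a.star c)) := by
  have key : ∀ i, ∃ T : Baire → Baire, ComputableFun T ∧ ∀ p q r,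
      r ∈ phi (fstB p) (pairing (consB i (fstB q)) (sndB q)) → r ∈ phi (T p) q := by
    intro i
    obtain ⟨T, hT, h⟩ := exists_curry_phi id.fst.fst ((id.snd.fst.cons i).pair id.snd.snd) id.snd
    exact ⟨T, hT, by simpa using h⟩
  obtain ⟨T, hT, hTe⟩ := key 0
  obtain ⟨S, hS, hSe⟩ := key 1
  refine ⟨fun p => if sndB p 0 = 0 then consB 0 (pairing (T p) (tailB (sndB p)))
    else consB 1 (pairing (S p) (tailB (sndB p))), fun z => tailB (sndB z),
    id.snd.ite ((hT.pair id.snd.tail).cons 0) ((hS.pair id.snd.tail).cons 1), id.snd.tail,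
    fun p hp => ?_⟩
  obtain ⟨h, hh⟩ := inst_star.1 hp
  obtain ⟨h0, h⟩ | ⟨h1, h⟩ := inst_sup.1 h
  · have hs : ∀ s, b.sol (tailB (sndB p)) (fstB s) →
        (b.sup c).sol (sndB p) (consB 0 (fstB s)) := fun s hs =>
      sol_sup.2 (Or.inl ⟨h0, by simp, by simpa using hs⟩)
    obtain ⟨h2, h3⟩ := star_intro (f := a) (e := T p) (P := fun s v => v ∈ phi (fstB p)
      (pairing (consB 0 (fstB s)) (sndB s))) h fun s hs' => by
        obtain ⟨w, hw, hi⟩ := hh (pairing (consB 0 (fstB s)) (sndB s)) (by simpa using hs s hs')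
        exact ⟨w, hTe _ _ _ hw, hi, hw⟩
    simp only [h0, if_true]
    refine ⟨inst_sup.2 (Or.inl ⟨rfl, by simpa using h2⟩), fun r hr => ?_⟩
    rcases sol_sup.1 hr with ⟨-, -, hr⟩ | ⟨h, -⟩
    · obtain ⟨s, w, hs', hw, h4, h5⟩ := h3 _ (by simpa using hr)
      exact sol_star.2 ⟨hp, _, by simpa using hs s hs', w, hw, by simpa using h4,
        by simpa using h5⟩
    · simp at h
  · have hs : ∀ s, c.sol (tailB (sndB p)) (fstB s) →
        (b.sup c).sol (sndB p) (consB 1 (fstB s)) := fun s hs =>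
      sol_sup.2 (Or.inr ⟨h1, by simp, by simpa using hs⟩)
    obtain ⟨h2, h3⟩ := star_intro (f := a) (e := S p) (P := fun s v => v ∈ phi (fstB p)
      (pairing (consB 1 (fstB s)) (sndB s))) h fun s hs' => by
        obtain ⟨w, hw, hi⟩ := hh (pairing (consB 1 (fstB s)) (sndB s)) (by simpa using hs s hs')
        exact ⟨w, hSe _ _ _ hw, hi, hw⟩
    simp only [h1, one_ne_zero, if_false]
    refine ⟨inst_sup.2 (Or.inr ⟨rfl, by simpa using h2⟩), fun r hr => ?_⟩
    rcases sol_sup.1 hr with ⟨h, -⟩ | ⟨-, -, hr⟩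
    · simp at h
    · obtain ⟨s, w, hs', hw, h4, h5⟩ := h3 _ (by simpa using hr)
      exact sol_star.2 ⟨hp, _, by simpa using hs s hs', w, hw, by simpa using h4,
        by simpa using h5⟩

lemma sup_star_reduces : ((a.star b).sup (a.star c)).TotReduces (a.star (b.sup c)) :=
  sup_le (star_mono (.refl a) (sup_left b c)) (star_mono (.refl a) (sup_right b c))

lemma star_sup_star_reduces : ((b.star a).sup (c.star a)).TotReduces ((b.sup c).star a) :=
  sup_le (star_mono (sup_left b c) (.refl a)) (star_mono (sup_right b c) (.refl a))

lemma inf_star_reduces : ((b.inf c).star a).TotReduces ((b.star a).inf (c.star a)) :=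
  le_inf (star_mono (inf_left b c) (.refl a)) (star_mono (inf_right b c) (.refl a))

lemma times_inf_reduces : (a.times (b.inf c)).TotReduces ((a.times b).inf (a.times c)) :=
  le_inf (times_mono (.refl a) (inf_left b c)) (times_mono (.refl a) (inf_right b c))

lemma star_inf_reduces : (a.star (b.inf c)).TotReduces ((a.star b).inf (a.star c)) :=
  le_inf (star_mono (.refl a) (inf_left b c)) (star_mono (.refl a) (inf_right b c))

/-- The tag of the answer of `b ⊓ c` tells which of the two programs to run. The tag itself travels
in the passed-on component, so that the final answer can be assigned to the right side. -/
lemma inf_star_star_reduces : ((a.star b).inf (a.star c)).TotReduces (a.star (b.inf c)) := by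
  obtain ⟨T, hT, hTe⟩ := exists_curry_phi (id.snd.fst.ite id.fst.fst.fst id.fst.snd.fst)
    (id.snd.fst.tail.pair id.snd.snd) ((id.fst.snd.fst.tag id.snd.fst).pair id.snd.snd)
  simp only [fstB_pairing, sndB_pairing] at hTe
  refine ⟨fun p => pairing (T p) (pairing (sndB (fstB p)) (sndB (sndB p))),
    fun z => tag (fstB (sndB z)) (pairing (tailB (fstB (sndB z))) (sndB (sndB z))),
    hT.pair (id.fst.snd.pair id.snd.snd), id.snd.fst.tag (id.snd.fst.tail.pair id.snd.snd),
    fun p hp => ?_⟩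
  obtain ⟨hb, hc⟩ := inst_inf.1 hp
  obtain ⟨hb1, hb2⟩ := inst_star.1 hb
  obtain ⟨hc1, hc2⟩ := inst_star.1 hc
  obtain ⟨h1, h2⟩ := star_intro (f := a) (g := b.inf c) (e := T p) (P := fun s v =>
      ∃ w ∈ phi (if fstB s 0 = 0 then fstB (fstB p) else fstB (sndB p))
        (pairing (tailB (fstB s)) (sndB s)), v = pairing (tag (fstB s) (fstB w)) (sndB w))
      (q := pairing (sndB (fstB p)) (sndB (sndB p))) (inst_inf.2 (by simpa using ⟨hb1, hc1⟩)) <| by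
    intro s hs
    obtain ⟨-, -, ⟨h0, hs⟩ | ⟨h0, hs⟩⟩ := sol_inf.1 hs
    · rw [fstB_pairing] at hs
      obtain ⟨w, hw, hi⟩ := hb2 (pairing (tailB (fstB s)) (sndB s)) (by simpa using hs)
      exact ⟨_, hTe _ _ w (by simpa [h0] using hw), by simpa using hi, w, by simpa [h0] using hw, rfl⟩
    · rw [sndB_pairing] at hs
      obtain ⟨w, hw, hi⟩ := hc2 (pairing (tailB (fstB s)) (sndB s)) (by simpa using hs)
      exact ⟨_, hTe _ _ w (by simpa [h0] using hw), by simpa using hi, w, by simpa [h0] using hw, rfl⟩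
  refine ⟨h1, fun r hr => sol_inf.2 ⟨hb, hc, ?_⟩⟩
  obtain ⟨s, v, hs, ⟨w, hw, rfl⟩, h3, h4⟩ := h2 r hr
  simp only [fstB_pairing, sndB_pairing] at h3 h4
  obtain ⟨-, -, ⟨h0, hs⟩ | ⟨h0, hs⟩⟩ := sol_inf.1 hs
  · refine Or.inl ⟨by simp [h3, h0], sol_star.2 ⟨hb, pairing (tailB (fstB s)) (sndB s),
      by simpa using hs, w, by simpa [h0] using hw, by simp [h3], by simpa using h4⟩⟩
  · refine Or.inr ⟨by simp [h3, h0], sol_star.2 ⟨hc, pairing (tailB (fstB s)) (sndB s),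
      by simpa using hs, w, by simpa [h0] using hw, by simp [h3], by simpa using h4⟩⟩

lemma sup_times_times_reduces : (a.sup (b.times c)).TotReduces ((a.sup b).times (a.sup c)) :=
  sup_le ((times_self a).trans (times_mono (sup_left a b) (sup_left a c)))
    (times_mono (sup_right a b) (sup_right a c))

lemma sup_star_star_reduces : (a.sup (b.star c)).TotReduces ((a.sup b).star (a.sup c)) :=
  sup_le ((star_self a).trans (star_mono (sup_left a b) (sup_left a c)))
    (star_mono (sup_right a b) (sup_right a c))

/-- The instance of `a` is used in both factors. If either answer is one for `a` it suffices;
otherwise both `b` and `c` have been answered. -/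
lemma inf_times_reduces : (a.inf (b.times c)).TotReduces ((a.inf b).times (a.inf c)) := by
  refine ⟨fun p => pairing (pairing (fstB p) (fstB (sndB p))) (pairing (fstB p) (sndB (sndB p))),
    fun z => if fstB (sndB z) 0 = 0 then fstB (sndB z) else if sndB (sndB z) 0 = 0 then
      sndB (sndB z) else consB 1 (pairing (tailB (fstB (sndB z))) (tailB (sndB (sndB z)))),
    (id.fst.pair id.snd.fst).pair (id.fst.pair id.snd.snd),
    id.snd.fst.ite id.snd.fst (id.snd.snd.ite id.snd.snd
      ((id.snd.fst.tail.pair id.snd.snd.tail).cons 1)), fun p hp => ?_⟩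
  have hp' := hp
  simp only [inst_inf, inst_times] at hp'
  obtain ⟨ha, hb, hc⟩ := hp'
  refine ⟨by simp [inst_times, inst_inf, ha, hb, hc], fun r hr => ?_⟩
  simp only [sol_times, sol_inf, fstB_pairing, sndB_pairing] at hr
  obtain ⟨⟨-, -, ⟨h0, h⟩ | ⟨h0, h⟩⟩, -, -, ⟨h1, h'⟩ | ⟨h1, h'⟩⟩ := hr <;>
    simp [sol_inf, sol_times, inst_times, *]

/-- The program of the solution is modified to put the tag of the instance, repeated in the tag of
the solution, in front of its output. -/
lemma impl_sup_reduces : (a.impl (b.sup c)).TotReduces ((a.impl b).sup (a.impl c)) := by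
  obtain ⟨T, hT, hTe⟩ := exists_curry_phi id.fst.tail.fst id.snd (id.fst.fst.tag id.snd)
  simp only [fstB_pairing, sndB_pairing] at hTe
  refine ⟨fun p => p, fun z => pairing (T (sndB z)) (sndB (tailB (sndB z))), id,
    (hT.comp id.snd).pair id.snd.tail.snd, fun p hp => ?_⟩
  obtain ⟨hp, ha⟩ := inst_impl.1 hp
  refine ⟨?_, fun r hr => ?_⟩
  · simpa [inst_sup, inst_impl, ha] using inst_sup.1 hp
  · rw [sol_impl, fstB_pairing, sndB_pairing, sndB_pairing]
    rcases sol_sup.1 hr with ⟨hp0, h0, hr⟩ | ⟨hp0, h0, hr⟩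
    · obtain ⟨-, h1, h2⟩ := sol_impl.1 hr
      refine ⟨hp, h1, fun s hs => ?_⟩
      obtain ⟨w, hw, hs⟩ := h2 s hs
      exact ⟨_, hTe _ _ _ hw, sol_sup.2 (Or.inl ⟨hp0, by simpa using h0, by simpa using hs⟩)⟩
    · obtain ⟨-, h1, h2⟩ := sol_impl.1 hr
      refine ⟨hp, h1, fun s hs => ?_⟩
      obtain ⟨w, hw, hs⟩ := h2 s hs
      exact ⟨_, hTe _ _ _ hw, sol_sup.2 (Or.inr ⟨hp0, by simp [h0], by simpa using hs⟩)⟩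

lemma sup_impl_reduces : ((a.impl b).sup (a.impl c)).TotReduces (a.impl (b.sup c)) :=
  sup_le (impl_mono (sup_left b c)) (impl_mono (sup_right b c))

/-- One instance of `a` serves both factors, and the program is composed with the two projections.
-/
lemma impl_times_reduces : ((a.impl b).times (a.impl c)).TotReduces (a.impl (b.times c)) := by
  obtain ⟨T, hT, hTe⟩ := exists_curry_phi id.fst.fst id.snd id.snd.fst
  obtain ⟨S, hS, hSe⟩ := exists_curry_phi id.fst.fst id.snd id.snd.snd
  simp only [fstB_pairing, sndB_pairing] at hTe hSe
  refine ⟨fun p => p, fun z => pairing (pairing (T (sndB z)) (sndB (sndB z)))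
    (pairing (S (sndB z)) (sndB (sndB z))), id,
    ((hT.comp id.snd).pair id.snd.snd).pair ((hS.comp id.snd).pair id.snd.snd), fun p hp => ?_⟩
  simp only [inst_times, inst_impl] at hp
  obtain ⟨⟨hb, ha⟩, hc, -⟩ := hp
  refine ⟨inst_impl.2 ⟨inst_times.2 ⟨hb, hc⟩, ha⟩, fun r hr => ?_⟩
  obtain ⟨-, h1, h2⟩ := sol_impl.1 hr
  simp only [sol_times, sol_impl, fstB_pairing, sndB_pairing]
  refine ⟨⟨hb, h1, fun s hs => ?_⟩, hc, h1, fun s hs => ?_⟩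
  · obtain ⟨w, hw, hs⟩ := h2 s hs
    exact ⟨_, hTe _ _ _ hw, (sol_times.1 hs).1⟩
  · obtain ⟨w, hw, hs⟩ := h2 s hs
    exact ⟨_, hSe _ _ _ hw, (sol_times.1 hs).2⟩

/-- Only the program from `a → c` is used. The answer of `b → c` merely supplies an instance of `b`
to complete the pair. -/
lemma times_impl_reduces : ((a.times b).impl c).TotReduces ((a.impl c).times (b.impl c)) := by
  obtain ⟨T, hT, hTe⟩ := exists_curry_phi id.fst.fst.fst (id.snd.fst.fst.pair id.snd.snd) id.snd
  simp only [fstB_pairing, sndB_pairing] at hTe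
  refine ⟨fun p => pairing p p, fun z => pairing (T (sndB z))
    (pairing (sndB (fstB (sndB z))) (sndB (sndB (sndB z)))), id.pair id,
    (hT.comp id.snd).pair (id.snd.fst.snd.pair id.snd.snd.snd), fun p hp => ?_⟩
  simp only [inst_times, inst_impl] at hp
  obtain ⟨hp, q, ha, hb⟩ := hp
  refine ⟨by simpa [inst_times, inst_impl, hp] using ⟨⟨_, ha⟩, ⟨_, hb⟩⟩, fun r hr => ?_⟩
  simp only [sol_times, sol_impl, fstB_pairing, sndB_pairing] at hr
  obtain ⟨⟨-, h1, h2⟩, -, h3, -⟩ := hr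
  rw [sol_impl, fstB_pairing, sndB_pairing, sndB_pairing]
  refine ⟨hp, by simpa [inst_times] using ⟨h1, h3⟩, fun s hs => ?_⟩
  simp only [sol_times, fstB_pairing] at hs
  obtain ⟨w, hw, hs⟩ := h2 (pairing (fstB (fstB s)) (sndB s)) (by simpa using hs.1)
  exact ⟨w, hTe _ _ _ hw, hs⟩

lemma impl_inf_reduces : (a.impl (b.inf c)).TotReduces ((a.impl b).inf (a.impl c)) :=
  le_inf (impl_mono (inf_left b c)) (impl_mono (inf_right b c))

/-- As for products: `b → c` supplies only an instance of `b`, and `a → c` supplies an instance of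
`a` and the program. The instance of `a ⋆ b` uses the program `R` that presents the known instance
of `a` whatever `b` answers. -/
lemma star_impl_reduces : ((a.star b).impl c).TotReduces ((a.impl c).star (b.impl c)) := by
  obtain ⟨T, hT, hTe⟩ := exists_curry (id.snd.fst.pair id.fst)
  obtain ⟨R, hR, hRe⟩ := exists_curry (id.snd.pair id.fst.snd.snd)
  obtain ⟨S, hS, hSe⟩ := exists_curry_phi id.fst.snd.fst (id.snd.fst.snd.pair id.snd.snd) id.snd
  simp only [fstB_pairing, sndB_pairing] at hTe hRe hSe
  refine ⟨fun p => pairing (T p) p, fun z => pairing (S (sndB z))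
    (pairing (R (sndB z)) (sndB (fstB (sndB z)))), hT.pair id,
    (hS.comp id.snd).pair ((hR.comp id.snd).pair id.snd.fst.snd), fun p hp => ?_⟩
  obtain ⟨hp, q, hq⟩ := inst_impl.1 hp
  obtain ⟨hb, hab⟩ := inst_star.1 hq
  have ha : ∃ q, a.inst q := by
    obtain ⟨s, hs⟩ := hb
    obtain ⟨w, -, hw⟩ := hab (pairing s s) (by simpa using hs)
    exact ⟨_, hw⟩
  obtain ⟨h1, h2⟩ := star_intro (f := a.impl c) (g := b.impl c) (e := T p)
    (P := fun s v => v = pairing (fstB s) p) (inst_impl.2 ⟨hp, _, hb⟩)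
    fun s hs => ⟨_, hTe _ _, by simpa using inst_impl.2 ⟨hp, ha⟩, rfl⟩
  refine ⟨h1, fun r hr => ?_⟩
  obtain ⟨s, v, hs, rfl, h3, h4⟩ := h2 r hr
  simp only [fstB_pairing, sndB_pairing] at h3 h4
  rw [← h3] at hs
  obtain ⟨-, h5, -⟩ := sol_impl.1 hs
  obtain ⟨-, h6, h7⟩ := sol_impl.1 h4
  obtain ⟨h8, h9⟩ := star_intro (f := a) (g := b) (e := R r) (q := sndB (fstB r))
    (P := fun s v => v = pairing s (sndB (sndB r))) h5 fun s hs => ⟨_, hRe _ _, by simpa using h6, rfl⟩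
  rw [sol_impl, fstB_pairing, sndB_pairing, sndB_pairing]
  refine ⟨hp, h8, fun s hs => ?_⟩
  obtain ⟨s', v, -, rfl, -, h10⟩ := h9 _ hs
  obtain ⟨w, hw, hs⟩ := h7 (pairing (sndB (fstB s)) (sndB s)) (by simpa using h10)
  exact ⟨w, hSe _ _ _ hw, hs⟩

/-- The same instance of `a` is presented in both rounds; the first answer is dropped and the second
is used. -/
lemma times_star_reduces : (a.times (b.star c)).TotReduces ((a.times b).star (a.times c)) := by
  obtain ⟨T, hT, hTe⟩ := exists_curry_phi id.fst.snd.fst (id.snd.fst.snd.pair id.snd.snd)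
    (id.snd.fst.pair (id.fst.fst.fst.pair id.snd.snd))
  simp only [fstB_pairing, sndB_pairing] at hTe
  refine ⟨fun p => pairing (T p) (pairing (fstB p) (sndB (sndB p))),
    fun z => pairing (fstB (sndB (sndB z))) (pairing (fstB (sndB z)) (sndB (sndB (sndB z)))),
    hT.pair (id.fst.pair id.snd.snd), id.snd.snd.fst.pair (id.snd.fst.pair id.snd.snd.snd),
    fun p hp => ?_⟩
  obtain ⟨ha, hbc⟩ := inst_times.1 hp
  obtain ⟨hc, hb⟩ := inst_star.1 hbc
  obtain ⟨h1, h2⟩ := star_intro (f := a.times b) (g := a.times c) (e := T p)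
      (q := pairing (fstB p) (sndB (sndB p))) (P := fun s v => ∃ w ∈ phi (fstB (sndB p))
        (pairing (sndB (fstB s)) (sndB s)), v = pairing (fstB w) (pairing (fstB p) (sndB w)))
      (inst_times.2 (by simpa using ⟨ha, hc⟩)) <| by
    intro s hs
    obtain ⟨w, hw, hi⟩ := hb (pairing (sndB (fstB s)) (sndB s))
      (by simpa using (sol_times.1 hs).2)
    exact ⟨_, hTe _ _ w hw, by simpa [inst_times] using ⟨ha, hi⟩, w, hw, rfl⟩
  refine ⟨h1, fun r hr => ?_⟩
  obtain ⟨s, v, hs, ⟨w, hw, rfl⟩, h3, h4⟩ := h2 r hr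
  simp only [fstB_pairing, sndB_pairing, sol_times] at hs h3 h4 ⊢
  exact ⟨h4.1, sol_star.2 ⟨hbc, _, by simpa using hs.2, w, hw, by simpa using h3,
    by simpa using h4.2⟩⟩

end Problem

/-! ### Extension to all degrees, including `0` and `∞` -/

namespace WProblem

open Problem TotReduces

variable {a b c : WProblem.{u}} {f g : Problem.{u}}

@[simp] lemma le_infty (a : WProblem.{u}) : a.le infty := by
  cases a <;> trivial

lemma _root_.Weihrauch.Problem.TotReduces.le (h : f.TotReduces g) : (fn f).le (fn g) := h.reduces

lemma le_refl (a : WProblem.{u}) : a.le a := by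
  cases a
  · exact (TotReduces.refl _).le
  · trivial

lemma equiv_refl (a : WProblem.{u}) : a.equiv a := ⟨le_refl a, le_refl a⟩

lemma fn_le_of_not_inst (h : ∀ p, ¬ f.inst p) (a : WProblem.{u}) : (fn f).le a := by
  cases a
  · exact (TotReduces.of_not_inst h).le
  · trivial

lemma zero_le (a : WProblem.{u}) : zero.le a := fn_le_of_not_inst not_inst_zero a

@[simp] lemma sup_fn (f g : Problem.{u}) : (fn f).sup (fn g) = fn (f.sup g) := rfl
@[simp] lemma sup_infty (a : WProblem.{u}) : a.sup infty = infty := by cases a <;> rfl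
@[simp] lemma infty_sup (a : WProblem.{u}) : infty.sup a = infty := by cases a <;> rfl
@[simp] lemma times_fn (f g : Problem.{u}) : (fn f).times (fn g) = fn (f.times g) := rfl
@[simp] lemma times_infty (a : WProblem.{u}) : a.times infty = infty := by cases a <;> rfl
@[simp] lemma infty_times (a : WProblem.{u}) : infty.times a = infty := by cases a <;> rfl
@[simp] lemma star_fn (f g : Problem.{u}) : (fn f).star (fn g) = fn (f.star g) := rfl
@[simp] lemma star_infty (a : WProblem.{u}) : a.star infty = infty := by cases a <;> rfl
@[simp] lemma infty_star (a : WProblem.{u}) : infty.star a = infty := by cases a <;> rfl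
@[simp] lemma inf_fn (f g : Problem.{u}) : (fn f).inf (fn g) = fn (f.inf g) := rfl
@[simp] lemma inf_infty (a : WProblem.{u}) : a.inf infty = a := by cases a <;> rfl
@[simp] lemma infty_inf (a : WProblem.{u}) : infty.inf a = a := by cases a <;> rfl
@[simp] lemma infty_impl (a : WProblem.{u}) : infty.impl a = zero := by cases a <;> rfl
@[simp] lemma impl_infty (f : Problem.{u}) : (fn f).impl infty = infty := rfl

lemma impl_fn (h : (∃ p, g.inst p) ∨ ∀ p, ¬ f.inst p) : (fn g).impl (fn f) = fn (g.impl f) :=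
  if_pos (h.imp dom_nonempty_iff.2 dom_eq_empty_iff.2)

lemma impl_fn_eq_infty (hg : ∀ p, ¬ g.inst p) (hf : ∃ p, f.inst p) :
    (fn g).impl (fn f) = infty := by
  refine if_neg ?_
  rw [dom_nonempty_iff, dom_eq_empty_iff, not_or, not_exists, not_forall_not]
  exact ⟨hg, hf⟩

lemma inst_of_reduces (h : f.Reduces g) (hf : ∃ p, f.inst p) : ∃ p, g.inst p := by
  obtain ⟨K, H, -, -, h⟩ := h.exists_fun
  obtain ⟨p, hp⟩ := hf
  obtain ⟨h, -, hi, -⟩ := h p hp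
  exact ⟨h, hi⟩

lemma fn_equiv_zero : (fn f).equiv zero ↔ ∀ p, ¬ f.inst p := by
  constructor
  · intro h p hp
    obtain ⟨q, hq⟩ := inst_of_reduces h.1 ⟨p, hp⟩
    exact not_inst_zero q hq
  · exact fun h => ⟨fn_le_of_not_inst h _, zero_le _⟩

@[simp] lemma not_fn_equiv_infty (f : Problem.{u}) : ¬ (fn f).equiv infty := fun h => h.2

lemma times_sup_equiv (a b c : WProblem.{u}) :
    (a.times (b.sup c)).equiv ((a.times b).sup (a.times c)) := by
  rcases a with a | _ <;> rcases b with b | _ <;> rcases c with c | _ <;>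
    simp only [sup_fn, times_fn, sup_infty, infty_sup, times_infty, infty_times, equiv_refl]
  exact ⟨times_sup_reduces.le, sup_times_reduces.le⟩

lemma star_sup_equiv (a b c : WProblem.{u}) :
    (a.star (b.sup c)).equiv ((a.star b).sup (a.star c)) := by
  rcases a with a | _ <;> rcases b with b | _ <;> rcases c with c | _ <;>
    simp only [sup_fn, star_fn, sup_infty, infty_sup, star_infty, infty_star, equiv_refl]
  exact ⟨star_sup_reduces.le, sup_star_reduces.le⟩

lemma star_sup_star_le (a b c : WProblem.{u}) :
    ((b.star a).sup (c.star a)).le ((b.sup c).star a) := by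
  rcases a with a | _ <;> rcases b with b | _ <;> rcases c with c | _ <;>
    simp only [sup_fn, star_fn, sup_infty, infty_sup, star_infty, infty_star, le_refl]
  exact star_sup_star_reduces.le

lemma inf_star_le (a b c : WProblem.{u}) :
    ((b.inf c).star a).le ((b.star a).inf (c.star a)) := by
  rcases a with a | _ <;> rcases b with b | _ <;> rcases c with c | _ <;>
    simp only [inf_fn, star_fn, inf_infty, infty_inf, star_infty, infty_star, le_refl]
  exact inf_star_reduces.le

lemma times_inf_le (a b c : WProblem.{u}) :
    (a.times (b.inf c)).le ((a.times b).inf (a.times c)) := by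
  rcases a with a | _ <;> rcases b with b | _ <;> rcases c with c | _ <;>
    simp only [inf_fn, times_fn, inf_infty, infty_inf, times_infty, infty_times, le_refl]
  exact times_inf_reduces.le

lemma star_inf_equiv (a b c : WProblem.{u}) :
    (a.star (b.inf c)).equiv ((a.star b).inf (a.star c)) := by
  rcases a with a | _ <;> rcases b with b | _ <;> rcases c with c | _ <;>
    simp only [inf_fn, star_fn, inf_infty, infty_inf, star_infty, infty_star, equiv_refl]
  exact ⟨star_inf_reduces.le, inf_star_star_reduces.le⟩

lemma sup_times_le (a b c : WProblem.{u}) :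
    (a.sup (b.times c)).le ((a.sup b).times (a.sup c)) := by
  rcases a with a | _ <;> rcases b with b | _ <;> rcases c with c | _ <;>
    simp only [sup_fn, times_fn, sup_infty, infty_sup, times_infty, infty_times, le_refl]
  exact sup_times_times_reduces.le

lemma sup_star_le (a b c : WProblem.{u}) :
    (a.sup (b.star c)).le ((a.sup b).star (a.sup c)) := by
  rcases a with a | _ <;> rcases b with b | _ <;> rcases c with c | _ <;>
    simp only [sup_fn, star_fn, sup_infty, infty_sup, star_infty, infty_star, le_refl]
  exact sup_star_star_reduces.le

lemma inf_times_le (a b c : WProblem.{u})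
    (h : a.equiv infty ∨ (b.equiv infty ↔ c.equiv infty)) :
    (a.inf (b.times c)).le ((a.inf b).times (a.inf c)) := by
  rcases a with a | _ <;> rcases b with b | _ <;> rcases c with c | _ <;>
    simp only [inf_fn, times_fn, inf_infty, infty_inf, times_infty, infty_times, le_refl]
  · exact inf_times_reduces.le
  · simp [equiv_refl] at h
  · simp [equiv_refl] at h
  -- Both `b` and `c` are `∞`, and the claim has become `a ≤ a × a`.
  · exact (times_self a).le

/-- If `a` is nowhere defined, both sides are `∞` as soon as `b` or `c` has an instance. -/
lemma impl_sup_equiv (a b c : WProblem.{u}) :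
    (a.impl (b.sup c)).equiv ((a.impl b).sup (a.impl c)) := by
  rcases a with a | _
  · rcases b with b | _ <;> rcases c with c | _ <;>
      simp only [sup_fn, sup_infty, infty_sup, impl_infty, equiv_refl]
    by_cases ha : ∃ p, a.inst p
    · rw [impl_fn (.inl ha), impl_fn (.inl ha), impl_fn (.inl ha)]
      exact ⟨impl_sup_reduces.le, sup_impl_reduces.le⟩
    by_cases hb : ∃ p, b.inst p
    · have hbc := inst_of_reduces (sup_left b c).reduces hb
      rw [impl_fn_eq_infty (not_exists.1 ha) hb, impl_fn_eq_infty (not_exists.1 ha) hbc, infty_sup]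
      exact equiv_refl _
    by_cases hc : ∃ p, c.inst p
    · have hbc := inst_of_reduces (sup_right b c).reduces hc
      rw [impl_fn_eq_infty (not_exists.1 ha) hc, impl_fn_eq_infty (not_exists.1 ha) hbc, sup_infty]
      exact equiv_refl _
    rw [not_exists] at hb hc
    rw [impl_fn (.inr hb), impl_fn (.inr hc), impl_fn (.inr fun p hp => ?_)]
    · exact ⟨impl_sup_reduces.le, sup_impl_reduces.le⟩
    · rcases inst_sup.1 hp with h | h
      · exact hb _ h.2
      · exact hc _ h.2
  · rw [infty_impl, infty_impl, infty_impl]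
    refine ⟨zero_le _, fn_le_of_not_inst (fun p hp => ?_) _⟩
    rcases inst_sup.1 hp with h | h
    · exact not_inst_zero _ h.2
    · exact not_inst_zero _ h.2

/-- The hypothesis excludes the case in which `a` and exactly one of `b`, `c` are `0` and the other
is not `∞`: there the left side is `∞`, whereas `b × c` and hence the right side are `0`. -/
lemma impl_times_le (a b c : WProblem.{u}) (h : ¬ a.equiv zero ∨ (b.equiv zero ↔ c.equiv zero) ∨
    b.equiv infty ∨ c.equiv infty) :
    ((a.impl b).times (a.impl c)).le (a.impl (b.times c)) := by
  rcases a with a | _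
  · rcases b with b | _ <;> rcases c with c | _ <;>
      simp only [times_fn, times_infty, infty_times, impl_infty, le_refl]
    by_cases ha : ∃ p, a.inst p
    · rw [impl_fn (.inl ha), impl_fn (.inl ha), impl_fn (.inl ha)]
      exact impl_times_reduces.le
    have h' : (∀ p, ¬ b.inst p) ↔ ∀ p, ¬ c.inst p := by
      simpa [fn_equiv_zero, not_exists.1 ha] using h
    by_cases hb : ∀ p, ¬ b.inst p
    · rw [impl_fn (.inr hb), impl_fn (.inr (h'.1 hb)), impl_fn (.inr fun p hp => ?_)]
      · exact impl_times_reduces.le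
      · exact hb _ (inst_times.1 hp).1
    · have hc := mt h'.2 hb
      rw [not_forall_not] at hb hc
      obtain ⟨p, hp⟩ := hb
      obtain ⟨q, hq⟩ := hc
      rw [impl_fn_eq_infty (f := b.times c) (not_exists.1 ha)
        ⟨pairing p q, inst_times.2 (by simpa using ⟨hp, hq⟩)⟩]
      exact le_infty _
  · rw [infty_impl, infty_impl]
    exact fn_le_of_not_inst (fun p hp => not_inst_zero _ (inst_times.1 hp).1) _

lemma times_impl_le (a b c : WProblem.{u}) :
    ((a.times b).impl c).le ((a.impl c).times (b.impl c)) := by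
  rcases a with a | _ <;> rcases b with b | _ <;>
    simp only [times_fn, times_infty, infty_times, infty_impl, zero_le]
  rcases c with c | _
  · by_cases ha : (∃ p, a.inst p) ∨ ∀ p, ¬ c.inst p
    · by_cases hb : (∃ p, b.inst p) ∨ ∀ p, ¬ c.inst p
      · rw [impl_fn ha, impl_fn hb, impl_fn]
        · exact times_impl_reduces.le
        · rcases ha with ⟨p, hp⟩ | ha
          · rcases hb with ⟨q, hq⟩ | hb
            · exact .inl ⟨pairing p q, inst_times.2 (by simpa using ⟨hp, hq⟩)⟩
            · exact .inr hb
          · exact .inr ha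
      · rw [not_or, not_exists, not_forall_not] at hb
        rw [impl_fn_eq_infty hb.1 hb.2, times_infty]
        exact le_infty _
    · rw [not_or, not_exists, not_forall_not] at ha
      rw [impl_fn_eq_infty ha.1 ha.2, infty_times]
      exact le_infty _
  · exact le_infty _

/-- For nowhere defined `a`, either `b ⊓ c` is nowhere defined as well and the left side is `0`, or
both `b` and `c` have instances and the right side is `∞`. -/
lemma impl_inf_le (a b c : WProblem.{u}) :
    (a.impl (b.inf c)).le ((a.impl b).inf (a.impl c)) := by
  rcases a with a | _
  · rcases b with b | _ <;> rcases c with c | _ <;>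
      simp only [inf_fn, inf_infty, infty_inf, impl_infty, le_refl]
    by_cases hb : (∃ p, a.inst p) ∨ ∀ p, ¬ b.inst p
    · by_cases hc : (∃ p, a.inst p) ∨ ∀ p, ¬ c.inst p
      · rw [impl_fn hb, impl_fn hc, impl_fn]
        · exact impl_inf_reduces.le
        · rcases hb with ha | hb
          · exact .inl ha
          · exact .inr fun p hp => hb _ (inst_inf.1 hp).1
      · rw [not_or, not_exists, not_forall_not] at hc
        rcases hb with ha | hb
        · exact absurd ha (not_exists.2 hc.1)
        · have h := fun p hp => hb _ (inst_inf (f := b) (g := c) (p := p).1 hp).1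
          rw [impl_fn (.inr h)]
          exact fn_le_of_not_inst (fun p hp => h p (inst_impl.1 hp).1) _
    · by_cases hc : (∃ p, a.inst p) ∨ ∀ p, ¬ c.inst p
      · rw [not_or, not_exists, not_forall_not] at hb
        rcases hc with ha | hc
        · exact absurd ha (not_exists.2 hb.1)
        · have h := fun p hp => hc _ (inst_inf (f := b) (g := c) (p := p).1 hp).2
          rw [impl_fn (.inr h)]
          exact fn_le_of_not_inst (fun p hp => h p (inst_impl.1 hp).1) _
      · rw [not_or, not_exists, not_forall_not] at hb hc
        rw [impl_fn_eq_infty hb.1 hb.2, impl_fn_eq_infty hc.1 hc.2]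
        exact le_infty _
  · rw [infty_impl]
    exact zero_le _

lemma exists_inst_star {f g : Problem.{u}} (hf : ∃ p, f.inst p) (hg : ∃ p, g.inst p) :
    ∃ p, (f.star g).inst p := by
  obtain ⟨p, hp⟩ := hf
  obtain ⟨q, hq⟩ := hg
  obtain ⟨e, he⟩ := exists_phi_const (pairing p p)
  exact ⟨pairing e q, inst_star.2 ⟨by simpa using hq, fun s _ => ⟨_, by simpa using he s,
    by simpa using hp⟩⟩⟩

lemma star_impl_le (a b c : WProblem.{u}) :
    ((a.star b).impl c).le ((a.impl c).star (b.impl c)) := by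
  rcases a with a | _ <;> rcases b with b | _ <;>
    simp only [star_fn, star_infty, infty_star, infty_impl, zero_le]
  rcases c with c | _
  · by_cases ha : (∃ p, a.inst p) ∨ ∀ p, ¬ c.inst p
    · by_cases hb : (∃ p, b.inst p) ∨ ∀ p, ¬ c.inst p
      · rw [impl_fn ha, impl_fn hb, impl_fn]
        · exact star_impl_reduces.le
        · rcases ha with ha | ha
          · rcases hb with hb | hb
            · exact .inl (exists_inst_star ha hb)
            · exact .inr hb
          · exact .inr ha
      · rw [not_or, not_exists, not_forall_not] at hb
        rw [impl_fn_eq_infty hb.1 hb.2, star_infty]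
        exact le_infty _
    · rw [not_or, not_exists, not_forall_not] at ha
      rw [impl_fn_eq_infty ha.1 ha.2, infty_star]
      exact le_infty _
  · exact le_infty _

lemma times_star_le (a b c : WProblem.{u}) :
    (a.times (b.star c)).le ((a.times b).star (a.times c)) := by
  rcases a with a | _ <;> rcases b with b | _ <;> rcases c with c | _ <;>
    simp only [star_fn, times_fn, star_infty, infty_star, times_infty, infty_times, le_refl]
  exact times_star_reduces.le

end WProblem

/-! ## Turing reducibility -/

/-- `r` is computable from `q`. -/
def TuringLE (r q : Baire) : Prop := ∃ e : Baire, Computable e ∧ r ∈ phi e q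

lemma ComputablePFun.turingLE {F : Baire →. Baire} (hF : ComputablePFun F) {q r : Baire}
    (h : r ∈ F q) : TuringLE r q := by
  obtain ⟨e, he, hF⟩ := hF
  exact ⟨e, he, hF q r h⟩

lemma ComputableFun.turingLE {f : Baire → Baire} (hf : ComputableFun f) (q : Baire) :
    TuringLE (f q) q := ComputablePFun.turingLE hf (Part.mem_some _)

namespace TuringLE

lemma refl (q : Baire) : TuringLE q q := ComputableFun.id.turingLE q

lemma phi {e s q w : Baire} (he : TuringLE e q) (hs : TuringLE s q) (hw : w ∈ phi e s) :
    TuringLE w q := by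
  obtain ⟨e₁, he₁, he⟩ := he
  obtain ⟨e₂, he₂, hs⟩ := hs
  refine (ComputablePFun.app
    (ComputablePFun.app (ComputablePFun.const he₁) ComputablePFun.some_id)
    (ComputablePFun.app (ComputablePFun.const he₂) ComputablePFun.some_id)).turingLE (q := q) ?_
  simp only [Part.bind_some, Part.mem_bind_iff]
  exact ⟨e, he, s, hs, hw⟩

lemma of_computable {c : Baire} (hc : Computable c) (q : Baire) : TuringLE c q :=
  (ComputableFun.const hc).turingLE q

lemma trans {r s q : Baire} (h₁ : TuringLE r s) (h₂ : TuringLE s q) : TuringLE r q := by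
  obtain ⟨e, he, h⟩ := h₁
  exact phi (of_computable he q) h₂ h

lemma comp {f : Baire → Baire} (hf : ComputableFun f) {r q : Baire} (h : TuringLE r q) :
    TuringLE (f r) q := (hf.turingLE r).trans h

lemma fst {r q : Baire} (h : TuringLE r q) : TuringLE (fstB r) q := h.comp ComputableFun.id.fst

lemma snd {r q : Baire} (h : TuringLE r q) : TuringLE (sndB r) q := h.comp ComputableFun.id.snd

lemma tail {r q : Baire} (h : TuringLE r q) : TuringLE (tailB r) q :=
  h.comp ComputableFun.id.tail

lemma cons (i : ℕ) {r q : Baire} (h : TuringLE r q) : TuringLE (consB i r) q :=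
  h.comp (ComputableFun.id.cons i)

lemma pair {r s q : Baire} (hr : TuringLE r q) (hs : TuringLE s q) :
    TuringLE (pairing r s) q := by
  obtain ⟨e₁, he₁, hr⟩ := hr
  obtain ⟨e₂, he₂, hs⟩ := hs
  refine (ComputablePFun.pairing
    (ComputablePFun.app (ComputablePFun.const he₁) ComputablePFun.some_id)
    (ComputablePFun.app (ComputablePFun.const he₂) ComputablePFun.some_id)).turingLE (q := q) ?_
  simp only [Part.bind_some, Part.mem_bind_iff, Part.mem_map_iff]
  exact ⟨r, hr, s, hs, rfl⟩

lemma left (q r : Baire) : TuringLE q (pairing q r) := by simpa using (refl (pairing q r)).fst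

lemma right (q r : Baire) : TuringLE r (pairing q r) := by simpa using (refl (pairing q r)).snd

end TuringLE

lemma countable_setOf_computable : {p : Baire | Computable p}.Countable := by
  have h : ∀ p : {p : Baire | Computable p}, ∃ c : Nat.Partrec.Code, c.eval = ↑p.1 := fun p =>
    Nat.Partrec.Code.exists_code.1 (Partrec.nat_iff.1 p.2)
  choose code hcode using h
  refine Set.countable_coe_iff.1 (Function.Injective.countable (f := code) fun p q hpq => ?_)
  have : (p.1 : ℕ →. ℕ) = q.1 := by rw [← hcode, ← hcode, hpq]
  exact Subtype.ext (funext fun n => Part.some_injective (congrFun this n))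

/-- Only countably many sequences are computable from `X`, while Baire space is uncountable by
diagonalization. -/
lemma exists_not_turingLE (X : Baire) : ∃ E, ¬ TuringLE E X := by
  by_contra! h
  have hc : (⋃ p ∈ {p : Baire | Computable p}, {r | r ∈ phi p X}).Countable :=
    countable_setOf_computable.biUnion fun p _ =>
      Set.Subsingleton.countable fun r hr s hs => Part.mem_unique hr hs
  have hu : (⋃ p ∈ {p : Baire | Computable p}, {r | r ∈ phi p X}) = Set.univ := by
    refine Set.eq_univ_of_forall fun r => ?_
    obtain ⟨p, hp, hr⟩ := h r
    exact Set.mem_biUnion hp hr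
  rw [hu, Set.countable_univ_iff] at hc
  obtain ⟨f, hf⟩ := exists_surjective_nat Baire
  obtain ⟨n, hn⟩ := hf fun n => f n n + 1
  have := congrFun hn n
  omega

open Topology in
/-- The graph of `phi p` is nowhere dense. -/
lemma dense_compl_closure_graph (p : Baire) :
    Dense (closure {x : Baire × Baire | x.2 ∈ phi p x.1})ᶜ := by
  rw [dense_iff_inter_open]
  rintro W hW ⟨⟨A, B⟩, hAB⟩
  obtain ⟨U, V, hU, hV, hA, hB, hUV⟩ := isOpen_prod_iff.1 hW A B hAB
  have hcyl : ∀ {x : Baire} {U : Set Baire}, IsOpen U → x ∈ U →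
      ∃ n, PiNat.cylinder x n ⊆ U := by
    intro x U hU hx
    obtain ⟨_, ⟨y, n, rfl⟩, hxy, hyU⟩ :=
      (PiNat.isTopologicalBasis_cylinders fun _ => ℕ).exists_subset_of_mem_open hx hU
    exact ⟨n, (PiNat.mem_cylinder_iff_eq.1 hxy).trans_subset hyU⟩
  obtain ⟨n, hn⟩ := hcyl hU hA
  obtain ⟨m, hm⟩ := hcyl hV hB
  by_cases h : ∃ A' B', A' ∈ PiNat.cylinder A n ∧ B' ∈ PiNat.cylinder B m ∧ B' ∈ phi p A'
  · obtain ⟨A', B', hA', -, hp⟩ := h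
    obtain ⟨k, hk, hj⟩ := mem_phi_iff.1 hp m
    -- The output symbol at `m` is fixed by the first `k` symbols of `A'`. Position `m` is the first
    -- one left free by the cylinder of `B`, so a wrong symbol may be put there, and all inputs near
    -- `A'` then miss it.
    refine ⟨(A', Function.update B m (B' m + 1)), hUV ⟨hn hA', hm ?_⟩, ?_⟩
    · exact fun i hi => by simp [hi.ne]
    · rw [Set.mem_compl_iff, mem_closure_iff]
      push Not
      refine ⟨PiNat.cylinder A' k ×ˢ {b | b m = B' m + 1}, (PiNat.isOpen_cylinder _ A' k).prod
        ((isOpen_discrete {B' m + 1}).preimage (continuous_apply (A := fun _ : ℕ => ℕ) m)),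
        ⟨PiNat.self_mem_cylinder _ _, by simp⟩, ?_⟩
      rw [Set.eq_empty_iff_forall_notMem]
      rintro ⟨A'', B''⟩ ⟨⟨h1, h2⟩, h3⟩
      obtain ⟨k', hk', hj'⟩ := mem_phi_iff.1 h3 m
      have hpre : ∀ j ≤ k, prefixCode A'' j = prefixCode A' j := fun j hj => by
        unfold prefixCode
        congr 1
        refine List.map_congr_left fun i hi => h1 i ?_
        have := List.mem_range.1 hi
        omega
      simp only [Set.mem_ofPred_eq] at h2 hk'
      rcases lt_trichotomy k' k with h | h | h
      · rw [hpre _ h.le, hj _ h] at hk'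
        omega
      · subst h
        rw [hpre _ le_rfl] at hk'
        omega
      · have := hj' k h
        rw [hpre _ le_rfl] at this
        omega
  · refine ⟨(A, B), hAB, ?_⟩
    rw [Set.mem_compl_iff, mem_closure_iff]
    push Not
    refine ⟨PiNat.cylinder A n ×ˢ PiNat.cylinder B m, (PiNat.isOpen_cylinder _ A n).prod
      (PiNat.isOpen_cylinder _ B m),
      ⟨PiNat.self_mem_cylinder _ _, PiNat.self_mem_cylinder _ _⟩, ?_⟩
    rw [Set.eq_empty_iff_forall_notMem]
    rintro ⟨A', B'⟩ ⟨⟨h1, h2⟩, h3⟩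
    exact h ⟨A', B', h1, h2, h3⟩

/-- There are Turing incomparable sequences. -/
lemma exists_incomparable : ∃ A B : Baire, ¬ TuringLE A B ∧ ¬ TuringLE B A := by
  have : Countable {p : Baire | Computable p} := countable_setOf_computable.to_subtype
  -- By Baire category a generic pair avoids the graphs of all computable functions; intersecting
  -- with the swapped set excludes both directions.
  have h₁ : Dense (⋂ p : {p : Baire | Computable p},
      (closure {x : Baire × Baire | x.2 ∈ phi p x.1})ᶜ) :=
    dense_iInter_of_isOpen (fun _ => isClosed_closure.isOpen_compl)
      fun p => dense_compl_closure_graph p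
  have hg : IsGδ (⋂ p : {p : Baire | Computable p},
      (closure {x : Baire × Baire | x.2 ∈ phi p x.1})ᶜ) :=
    IsGδ.iInter_of_isOpen fun _ => isClosed_closure.isOpen_compl
  have h₂ : Dense (Prod.swap ⁻¹' (⋂ p : {p : Baire | Computable p},
      (closure {x : Baire × Baire | x.2 ∈ phi p x.1})ᶜ)) :=
    h₁.preimage (Homeomorph.prodComm Baire Baire).isOpenMap
  obtain ⟨⟨A, B⟩, hA, hB⟩ := (h₁.inter_of_Gδ hg (hg.preimage continuous_swap) h₂).nonempty
  have key : ∀ A B : Baire, (A, B) ∈ (⋂ p : {p : Baire | Computable p},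
      (closure {x : Baire × Baire | x.2 ∈ phi p x.1})ᶜ) → ¬ TuringLE B A := by
    rintro A B h ⟨p, hp, hAB⟩
    exact Set.mem_iInter.1 h ⟨p, hp⟩ (subset_closure hAB)
  exact ⟨A, B, key _ _ hB, key _ _ hA⟩

/-- The sequence is computable from every sequence. -/
def Recursive (p : Baire) : Prop := ∀ X, TuringLE p X

lemma Recursive.pair {p q : Baire} (hp : Recursive p) (hq : Recursive q) :
    Recursive (pairing p q) := fun X => (hp X).pair (hq X)

lemma Recursive.cons (i : ℕ) {p : Baire} (hp : Recursive p) : Recursive (consB i p) :=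
  fun X => (hp X).cons i

lemma recursive_of_turingLE {p q : Baire} (h : TuringLE p q) (hq : Recursive q) : Recursive p :=
  fun X => h.trans (hq X)

/-! ### Test problems, and what a reduction does to Turing degrees -/

namespace Problem

variable {f g : Problem.{u}}

/-- The problem on Baire space with the given solution relation. -/
def ofRel (R : Baire → Baire → Prop) : Problem.{u} where
  src := ⟨ULift Baire, fun p => Part.some ⟨p⟩, fun x => ⟨x.down, Part.mem_some _⟩⟩
  tgt := ⟨ULift Baire, fun p => Part.some ⟨p⟩, fun x => ⟨x.down, Part.mem_some _⟩⟩
  map := fun x => {y | R x.down y.down}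

lemma sol_ofRel {R : Baire → Baire → Prop} {p r : Baire} : (ofRel.{u} R).sol p r ↔ R p r := by
  constructor
  · rintro ⟨x, hx, y, hy, h⟩
    cases Part.mem_some_iff.1 hx
    cases Part.mem_some_iff.1 hy
    exact h
  · exact fun h => ⟨⟨p⟩, Part.mem_some _, ⟨r⟩, Part.mem_some _, h⟩

/-- The problem with the only instance `x`, which has the only solution `A`. -/
def single (x A : Baire) : Problem.{u} := ofRel fun p r => p = x ∧ r = A

/-- The problem with the instances `x` and `y`, which have the only solutions `A` and `B`. -/
def double (x A y B : Baire) : Problem.{u} := ofRel fun p r => p = x ∧ r = A ∨ p = y ∧ r = B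

/-- The problem with the only instance `x`, which has the solutions `A` and `B`. -/
def choice (x A B : Baire) : Problem.{u} := ofRel fun p r => p = x ∧ (r = A ∨ r = B)

variable {x y A B p q r : Baire}

@[simp] lemma sol_single : (single.{u} x A).sol p r ↔ p = x ∧ r = A := sol_ofRel

@[simp] lemma sol_double :
    (double.{u} x A y B).sol p r ↔ p = x ∧ r = A ∨ p = y ∧ r = B := sol_ofRel

@[simp] lemma sol_choice : (choice.{u} x A B).sol p r ↔ p = x ∧ (r = A ∨ r = B) := sol_ofRel

@[simp] lemma inst_single : (single.{u} x A).inst p ↔ p = x := by simp [inst]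

@[simp] lemma inst_double : (double.{u} x A y B).inst p ↔ p = x ∨ p = y := by
  simp [inst, exists_or]

@[simp] lemma inst_choice : (choice.{u} x A B).inst p ↔ p = x := by simp [inst]

/-- This is the obstruction behind all counterexamples: it suffices to find a recursive instance of
`f` for which no `q` as described exists. -/
lemma Reduces.exists_recursive (h : f.Reduces g) (hp : Recursive p) (hi : f.inst p) :
    ∃ q, Recursive q ∧ g.inst q ∧
      ∀ X r, TuringLE r X → g.sol q r → ∃ k, TuringLE k X ∧ f.sol p k := by
  obtain ⟨K, H, hK, hH, h⟩ := h.exists_fun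
  obtain ⟨q, hq, hqi, h⟩ := h p hi
  refine ⟨q, recursive_of_turingLE (hH.turingLE hq) hp, hqi, fun X r hr hs => ?_⟩
  obtain ⟨k, hk, hs⟩ := h r hs
  exact ⟨k, (hK.turingLE hk).trans ((hp X).pair hr), hs⟩

lemma exists_star_inst (hq : g.inst q) (hqr : Recursive q) {v : Baire → Baire}
    (hv : ComputableFun v) (h : ∀ s, g.sol q (fstB s) → f.inst (sndB (v s))) :
    ∃ p, Recursive p ∧ (f.star g).inst p ∧ ∀ r, (f.star g).sol p r →
      ∃ s, g.sol q (fstB s) ∧ fstB r = fstB (v s) ∧ f.sol (sndB (v s)) (sndB r) := by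
  obtain ⟨e, he, hev⟩ := hv.exists_name
  obtain ⟨h1, h2⟩ := star_intro (f := f) (e := e) (P := fun s w => w = v s) hq
    fun s hs => ⟨_, hev s, h s hs, rfl⟩
  refine ⟨_, Recursive.pair (TuringLE.of_computable he) hqr, h1, fun r hr => ?_⟩
  obtain ⟨s, v, hs, rfl, h3⟩ := h2 r hr
  exact ⟨s, hs, h3⟩

/-- With a recursive instance of `f ⋆ g`, the second question cannot contain more information than
an answer to the first one. -/
lemma inst.star_step (hp : (f.star g).inst p) {X : Baire} (hX : Recursive p)
    (hr : g.sol (sndB p) r) (hrX : TuringLE r X) : ∃ w, TuringLE w X ∧ f.inst (sndB w) ∧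
      ∀ t, f.sol (sndB w) t → (f.star g).sol p (pairing (fstB w) t) := by
  obtain ⟨-, h⟩ := inst_star.1 hp
  obtain ⟨w, hw, hi⟩ := h (pairing r r) (by simpa using hr)
  exact ⟨w, (hX X).fst.phi (hrX.pair hrX) hw, hi, fun t ht =>
    sol_star.2 ⟨hp, _, by simpa using hr, w, hw, by simp, by simpa using ht⟩⟩

lemma exists_impl_sol (hp : f.inst p) (hq : g.inst q) (hqr : Recursive q) {v : Baire → Baire}
    (hv : ComputableFun v) (h : ∀ s, g.sol q (fstB s) → f.sol p (v s)) :
    ∃ r, Recursive r ∧ (g.impl f).sol p r := by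
  obtain ⟨e, he, hev⟩ := hv.exists_name
  exact ⟨pairing e q, Recursive.pair (TuringLE.of_computable he) hqr, sol_impl.2 ⟨hp, by simpa using hq,
    fun s hs => ⟨v s, by simpa using hev s, h s (by simpa using hs)⟩⟩⟩

/-- The program in the solution turns an answer for its instance of `g` into an answer for `p`,
without leaving what `X` computes. -/
lemma sol.impl_step (h : (g.impl f).sol p r) {X s : Baire} (hr : TuringLE r X)
    (hs : g.sol (sndB r) s) (hsX : TuringLE s X) : ∃ w, TuringLE w X ∧ f.sol p w := by
  obtain ⟨-, -, h⟩ := sol_impl.1 h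
  obtain ⟨w, hw, h⟩ := h (pairing s s) (by simpa using hs)
  exact ⟨w, hr.fst.phi (hsX.pair hsX) hw, h⟩

end Problem

/-- The constant sequence `0`. -/
def zeroB : Baire := fun _ => 0

/-- The constant sequence `1`. -/
def oneB : Baire := fun _ => 1

lemma computable_zeroB : Computable zeroB := Computable.const 0

lemma computable_oneB : Computable oneB := Computable.const 1

lemma recursive_zeroB : Recursive zeroB := TuringLE.of_computable computable_zeroB

lemma recursive_oneB : Recursive oneB := TuringLE.of_computable computable_oneB

@[simp] lemma oneB_ne_zeroB : oneB ≠ zeroB := fun h => one_ne_zero (congrFun h 0)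

@[simp] lemma zeroB_ne_oneB : zeroB ≠ oneB := oneB_ne_zeroB.symm

/-! ### Counterexamples -/

namespace Problem

open ComputableFun

variable {A B E : Baire}

lemma ne_zeroB (hAB : ¬ TuringLE A B) : A ≠ zeroB := by
  rintro rfl
  exact hAB (recursive_zeroB B)

/-- In the source the tag of the answer selects the summand. The target must select it in advance;
if it expects the instance `A`, the answer may be `B`, and conversely. -/
lemma not_sup_star_reduces (hAB : ¬ TuringLE A B) (hBA : ¬ TuringLE B A) :
    ¬ (((single.{u} A zeroB).sup (single B zeroB)).star
        (choice zeroB (consB 0 A) (consB 1 B))).Reduces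
      (((single A zeroB).star (choice zeroB (consB 0 A) (consB 1 B))).sup
        ((single B zeroB).star (choice zeroB (consB 0 A) (consB 1 B)))) := by
  intro h
  obtain ⟨p, hp, hpi, -⟩ := exists_star_inst (f := (single.{u} A zeroB).sup (single B zeroB))
    (g := choice zeroB (consB 0 A) (consB 1 B)) (q := zeroB) (by simp) recursive_zeroB
    (id.pair id.fst) (by
      intro s hs
      rcases (sol_choice.1 hs).2 with h | h <;> simp [inst_sup, h])
  obtain ⟨q, hq, hqi, -⟩ := h.exists_recursive hp hpi
  rcases inst_sup.1 hqi with ⟨-, h⟩ | ⟨-, h⟩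
  · have hz := inst_choice.1 (inst_star.1 h).1
    obtain ⟨w, hw, hi, -⟩ := h.star_step (X := B) (r := consB 1 B)
      (fun X => (hq X).tail) (by simp [hz]) ((TuringLE.refl B).cons 1)
    rw [inst_single] at hi
    exact hAB (hi ▸ hw.snd)
  · have hz := inst_choice.1 (inst_star.1 h).1
    obtain ⟨w, hw, hi, -⟩ := h.star_step (X := A) (r := consB 0 A)
      (fun X => (hq X).tail) (by simp [hz]) ((TuringLE.refl A).cons 0)
    rw [inst_single] at hi
    exact hBA (hi ▸ hw.snd)

/-- The source asks `double` twice and obtains both `A` and `B` as instances. The target asks once,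
but its next question must contain both. -/
lemma not_star_inf_star_reduces (hAB : ¬ TuringLE A B) (hBA : ¬ TuringLE B A) :
    ¬ (((single.{u} A zeroB).star (double zeroB A oneB B)).inf
        ((single B zeroB).star (double zeroB A oneB B))).Reduces
      (((single A zeroB).inf (single B zeroB)).star (double zeroB A oneB B)) := by
  intro h
  obtain ⟨p, hp, hpi, -⟩ := exists_star_inst (f := single.{u} A zeroB)
    (g := double zeroB A oneB B) (q := zeroB) (by simp) recursive_zeroB
    (id.pair id.fst) (by simp)
  obtain ⟨p', hp', hpi', -⟩ := exists_star_inst (f := single.{u} B zeroB)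
    (g := double zeroB A oneB B) (q := oneB) (by simp) recursive_oneB
    (id.pair id.fst) (by simp)
  obtain ⟨q, hq, hqi, -⟩ := h.exists_recursive (hp.pair hp')
    (inst_inf.2 (by simpa using ⟨hpi, hpi'⟩))
  rcases inst_double.1 (inst_star.1 hqi).1 with hz | hz
  · obtain ⟨w, hw, hi, -⟩ := hqi.star_step hq (by simp [hz]) (TuringLE.refl A)
    simp only [inst_inf, inst_single] at hi
    exact hBA (hi.2 ▸ hw.snd.snd)
  · obtain ⟨w, hw, hi, -⟩ := hqi.star_step (r := B) hq (by simp [hz]) (TuringLE.refl B)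
    simp only [inst_inf, inst_single] at hi
    exact hAB (hi.1 ▸ hw.snd.fst)

/-- At the chosen instance every solution of the source contains both `A` and `B`. In the target,
`⊓` may repeat the sequence that `double` has already given. -/
lemma not_times_inf_times_reduces (hAB : ¬ TuringLE A B) (hBA : ¬ TuringLE B A) :
    ¬ (((double.{u} zeroB A oneB B).times (single zeroB B)).inf
        ((double zeroB A oneB B).times (single zeroB A))).Reduces
      ((double zeroB A oneB B).times ((single zeroB B).inf (single zeroB A))) := by
  intro h
  obtain ⟨q, hq, hqi, h⟩ := h.exists_recursive
    ((recursive_zeroB.pair recursive_zeroB).pair (recursive_oneB.pair recursive_zeroB))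
    (by simp [inst_inf, inst_times])
  simp only [inst_times, inst_inf, inst_single, inst_double] at hqi
  obtain ⟨hz | hz, hz1, hz2⟩ := hqi
  · obtain ⟨k, hk, hs⟩ := h A (pairing A (consB 1 A))
      ((TuringLE.refl A).pair ((TuringLE.refl A).cons 1))
      (by simp [sol_times, sol_inf, hz, hz1, hz2])
    simp [sol_inf, sol_times, inst_times] at hs
    rcases hs with ⟨-, -, hs⟩ | ⟨-, hs, -⟩
    · exact hBA (hs ▸ hk.tail.snd)
    · exact hBA (hs ▸ hk.tail.fst)
  · obtain ⟨k, hk, hs⟩ := h B (pairing B (consB 0 B))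
      ((TuringLE.refl B).pair ((TuringLE.refl B).cons 0))
      (by simp [sol_times, sol_inf, hz, hz1, hz2])
    simp [sol_inf, sol_times, inst_times] at hs
    rcases hs with ⟨-, hs, -⟩ | ⟨-, -, hs⟩
    · exact hAB (hs ▸ hk.tail.fst)
    · exact hAB (hs ▸ hk.tail.snd)

/-- The source delivers `A` and `B` at a recursive instance. In the target the first summand gives
only `A`, and the second has no recursive instance, as `A` is not recursive. -/
lemma not_sup_times_sup_reduces (hAB : ¬ TuringLE A B) (hBA : ¬ TuringLE B A) :
    ¬ (((single.{u} zeroB A).sup (single A zeroB)).times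
        ((single zeroB A).sup (single zeroB B))).Reduces
      ((single zeroB A).sup ((single A zeroB).times (single zeroB B))) := by
  intro h
  obtain ⟨q, hq, hqi, h⟩ := h.exists_recursive
    ((recursive_zeroB.cons 0).pair (recursive_zeroB.cons 1))
    (by simp [inst_sup, inst_times])
  simp only [inst_times, inst_sup, inst_single] at hqi
  rcases hqi with ⟨h0, hz⟩ | ⟨-, hz, -⟩
  · obtain ⟨k, hk, hs⟩ := h A (consB 0 A) ((TuringLE.refl A).cons 0) (by simp [sol_sup, h0, hz])
    simp [sol_sup, sol_times] at hs
    exact hBA (hs.2.2 ▸ hk.snd.tail)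
  · exact hAB (hz ▸ (hq B).tail.fst)

/-- The source obtains `B` and passes it on. The target either gives only `A`, or must produce the
instance `A` from the answer `B`. -/
lemma not_sup_star_sup_reduces (hAB : ¬ TuringLE A B) (hBA : ¬ TuringLE B A) :
    ¬ (((single.{u} zeroB A).sup (single A zeroB)).star
        ((single zeroB A).sup (single zeroB B))).Reduces
      ((single zeroB A).sup ((single A zeroB).star (single zeroB B))) := by
  intro h
  obtain ⟨p, hp, hpi, hps⟩ := exists_star_inst (f := (single.{u} zeroB A).sup (single A zeroB))
    (g := (single zeroB A).sup (single zeroB B)) (q := consB 1 zeroB) (by simp [inst_sup])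
    (recursive_zeroB.cons 1) (id.pair ((const computable_zeroB).cons 0))
    (by simp [inst_sup])
  obtain ⟨q, hq, hqi, h⟩ := h.exists_recursive hp hpi
  rcases inst_sup.1 hqi with ⟨h0, hz⟩ | ⟨-, hz⟩
  · rw [inst_single] at hz
    obtain ⟨k, hk, hs⟩ := h A (consB 0 A) ((TuringLE.refl A).cons 0) (by simp [sol_sup, h0, hz])
    obtain ⟨s, hs, h1, -⟩ := hps k hs
    simp [sol_sup] at hs h1
    exact hBA (hs.2 ▸ h1 ▸ hk.fst.fst.tail)
  · obtain ⟨w, hw, hi, -⟩ := hz.star_step (X := B) (r := B) (fun X => (hq X).tail)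
      (by simpa using (inst_star.1 hz).1) (TuringLE.refl B)
    rw [inst_single] at hi
    exact hAB (hi ▸ hw.snd)

/-- The first factor yields `A` and the second `B`, whichever sides of `⊓` are answered. The target
may answer only `double`, that is, with `A` or `B` alone. -/
lemma not_inf_times_inf_reduces (hAB : ¬ TuringLE A B) (hBA : ¬ TuringLE B A) :
    ¬ (((double.{u} zeroB A oneB B).inf (single zeroB A)).times
        ((double zeroB A oneB B).inf (single zeroB B))).Reduces
      ((double zeroB A oneB B).inf ((single zeroB A).times (single zeroB B))) := by
  intro h
  obtain ⟨q, hq, hqi, h⟩ := h.exists_recursive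
    ((recursive_zeroB.pair recursive_zeroB).pair (recursive_oneB.pair recursive_zeroB))
    (by simp [inst_inf, inst_times])
  simp only [inst_times, inst_inf, inst_single, inst_double] at hqi
  obtain ⟨hz | hz, hz1, hz2⟩ := hqi
  · obtain ⟨k, hk, hs⟩ := h A (consB 0 A) ((TuringLE.refl A).cons 0)
      (by simp [sol_inf, inst_times, hz, hz1, hz2])
    simp [sol_inf, sol_times] at hs
    rcases hs with ⟨-, ⟨-, hs⟩ | ⟨-, hs⟩⟩ <;> exact hBA (hs ▸ hk.snd.tail)
  · obtain ⟨k, hk, hs⟩ := h B (consB 0 B) ((TuringLE.refl B).cons 0)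
      (by simp [sol_inf, inst_times, hz, hz1, hz2])
    simp [sol_inf, sol_times] at hs
    rcases hs with ⟨⟨-, hs⟩ | ⟨-, hs⟩, -⟩ <;> exact hAB (hs ▸ hk.fst.tail)

/-- The two separate implications have recursive solutions that use different instances of `double`.
The source needs a single instance whose answer computes both `A` and `B`. -/
lemma not_impl_times_reduces (hAB : ¬ TuringLE A B) (hBA : ¬ TuringLE B A) :
    ¬ ((double.{u} zeroB A oneB B).impl ((single zeroB A).times (single zeroB B))).Reduces
      (((double zeroB A oneB B).impl (single zeroB A)).times
        ((double zeroB A oneB B).impl (single zeroB B))) := by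
  intro h
  obtain ⟨q, hq, hqi, h⟩ := h.exists_recursive (recursive_zeroB.pair recursive_zeroB)
    (by simp [inst_impl, inst_times])
  simp only [inst_times, inst_impl, inst_single] at hqi
  obtain ⟨⟨h1, -⟩, h2, -⟩ := hqi
  obtain ⟨r, hr, hrs⟩ := exists_impl_sol (f := single.{u} zeroB A) (g := double zeroB A oneB B)
    (p := zeroB) (q := zeroB) (by simp) (by simp) recursive_zeroB id.fst (by simp)
  obtain ⟨r', hr', hrs'⟩ := exists_impl_sol (f := single.{u} zeroB B) (g := double zeroB A oneB B)
    (p := zeroB) (q := oneB) (by simp) (by simp) recursive_oneB id.fst (by simp)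
  obtain ⟨k, hk, hs⟩ := h zeroB (pairing r r') (hr.pair hr' _)
    (sol_times.2 (by simpa [h1, h2] using ⟨hrs, hrs'⟩))
  have hk := recursive_of_turingLE hk recursive_zeroB
  rcases inst_double.1 (sol_impl.1 hs).2.1 with hz | hz
  · obtain ⟨w, hw, hws⟩ := hs.impl_step (hk A) (by simp [hz]) (TuringLE.refl A)
    simp [sol_times] at hws
    exact hBA (hws.2 ▸ hw.snd)
  · obtain ⟨w, hw, hws⟩ := hs.impl_step (s := B) (hk B) (by simp [hz]) (TuringLE.refl B)
    simp [sol_times] at hws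
    exact hAB (hws.1 ▸ hw.fst)

/-- With both `A` and `B` at hand a recursive program outputs their pair, so the target has a
recursive solution. The factor with `A` alone would then compute `B` from `A`. -/
lemma not_impl_times_impl_reduces (hBA : ¬ TuringLE B A) :
    ¬ (((single.{u} zeroB A).impl (single zeroB (pairing A B))).times
        ((single zeroB B).impl (single zeroB (pairing A B)))).Reduces
      (((single zeroB A).times (single zeroB B)).impl (single zeroB (pairing A B))) := by
  intro h
  obtain ⟨q, hq, hqi, h⟩ := h.exists_recursive (recursive_zeroB.pair recursive_zeroB)
    (by simp [inst_impl, inst_times])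
  have hqz := inst_single.1 (inst_impl.1 hqi).1
  obtain ⟨r, hr, hrs⟩ := exists_impl_sol (f := single.{u} zeroB (pairing A B))
    (g := (single zeroB A).times (single zeroB B)) (p := zeroB) (q := pairing zeroB zeroB)
    (by simp) (by simp [inst_times]) (recursive_zeroB.pair recursive_zeroB)
    (id.fst.fst.pair id.fst.snd) (by simp +contextual [sol_times])
  obtain ⟨k, hk, hs⟩ := h A r (hr _) (hqz ▸ hrs)
  have hs := (sol_times.1 hs).1
  obtain ⟨w, hw, hws⟩ := hs.impl_step hk.fst
    (by simpa using (sol_impl.1 hs).2.1) (TuringLE.refl A)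
  rw [sol_single] at hws
  exact hBA ((TuringLE.right A B).trans (hws.2 ▸ hw))

/-- The tags of `choice` match those of `⊓`, so the identity solves the target. The source commits
to one of `A` and `B`, and `choice` may give the other. -/
lemma not_impl_inf_impl_reduces (hAB : ¬ TuringLE A B) (hBA : ¬ TuringLE B A) :
    ¬ (((choice.{u} zeroB (consB 0 A) (consB 1 B)).impl (single zeroB A)).inf
        ((choice zeroB (consB 0 A) (consB 1 B)).impl (single zeroB B))).Reduces
      ((choice zeroB (consB 0 A) (consB 1 B)).impl ((single zeroB A).inf (single zeroB B))) := by
  intro h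
  obtain ⟨q, hq, hqi, h⟩ := h.exists_recursive (recursive_zeroB.pair recursive_zeroB)
    (by simp [inst_impl, inst_inf])
  have hqz := (inst_impl.1 hqi).1
  obtain ⟨r, hr, hrs⟩ := exists_impl_sol (f := (single.{u} zeroB A).inf (single zeroB B))
    (g := choice zeroB (consB 0 A) (consB 1 B)) (q := zeroB) hqz (by simp) recursive_zeroB id.fst
    (by
      simp only [inst_inf, inst_single] at hqz
      intro s hs
      rcases (sol_choice.1 hs).2 with h | h <;> simp [sol_inf, h, hqz])
  obtain ⟨k, hk, hs⟩ := h zeroB r (hr _) hrs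
  have hk := recursive_of_turingLE hk recursive_zeroB
  obtain ⟨-, -, ⟨-, hs⟩ | ⟨-, hs⟩⟩ := sol_inf.1 hs
  · have hz := inst_choice.1 (sol_impl.1 hs).2.1
    obtain ⟨w, hw, hws⟩ := hs.impl_step (s := consB 1 B) (hk B).tail (by simp [hz])
      ((TuringLE.refl B).cons 1)
    rw [sol_single] at hws
    exact hAB (hws.2 ▸ hw)
  · have hz := inst_choice.1 (sol_impl.1 hs).2.1
    obtain ⟨w, hw, hws⟩ := hs.impl_step (s := consB 0 A) (hk A).tail (by simp [hz])
      ((TuringLE.refl A).cons 0)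
    rw [sol_single] at hws
    exact hBA (hws.2 ▸ hw)

/-- Asking for `B` and then `A`, and passing `B` on, lets a recursive program recover the pair; so
the target has a recursive solution. The outer implication of the source would then compute `B` from
`A`. -/
lemma not_impl_star_impl_reduces (hBA : ¬ TuringLE B A) :
    ¬ (((single.{u} zeroB A).impl (single zeroB (pairing A B))).star
        ((single zeroB B).impl (single zeroB (pairing A B)))).Reduces
      (((single zeroB A).star (single zeroB B)).impl (single zeroB (pairing A B))) := by
  intro h
  obtain ⟨p, hp, hpi, hps⟩ := exists_star_inst
    (f := (single.{u} zeroB A).impl (single zeroB (pairing A B)))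
    (g := (single zeroB B).impl (single zeroB (pairing A B))) (q := zeroB)
    (by simp [inst_impl]) recursive_zeroB (id.pair (const computable_zeroB))
    (by simp [inst_impl])
  obtain ⟨q, hq, hqi, h⟩ := h.exists_recursive hp hpi
  have hqz := inst_single.1 (inst_impl.1 hqi).1
  obtain ⟨p', hp', hpi', hps'⟩ := exists_star_inst (f := single.{u} zeroB A)
    (g := single zeroB B) (q := zeroB) (by simp) recursive_zeroB
    (id.fst.pair (const computable_zeroB)) (by simp)
  obtain ⟨r, hr, hrs⟩ := exists_impl_sol (f := single.{u} zeroB (pairing A B))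
    (g := (single zeroB A).star (single zeroB B)) (p := zeroB)
    (by simp) hpi' hp' (id.fst.snd.pair id.fst.fst) (by
      intro s hs
      obtain ⟨s', h1, h2, h3⟩ := hps' _ hs
      simp only [fstB_pairing, sndB_pairing, sol_single] at h1 h2 h3
      simp [h3.2, h2, h1.2])
  obtain ⟨k, hk, hs⟩ := h A r (hr _) (hqz ▸ hrs)
  obtain ⟨s, -, -, hs⟩ := hps _ hs
  obtain ⟨w, hw, hws⟩ := hs.impl_step hk.snd
    (by simpa using (sol_impl.1 hs).2.1) (TuringLE.refl A)
  rw [sol_single] at hws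
  exact hBA ((TuringLE.right A B).trans (hws.2 ▸ hw))

/-- The source applies `double` twice, from `zeroB` to `A` and from `A` to `B`. The target applies
it once, at a recursive instance, hence at `zeroB`, and gets only `A`. -/
lemma not_times_star_times_reduces (hAB : ¬ TuringLE A B) (hBA : ¬ TuringLE B A) :
    ¬ (((double.{u} zeroB A A B).times (single zeroB zeroB)).star
        ((double zeroB A A B).times (single zeroB zeroB))).Reduces
      ((double zeroB A A B).times ((single zeroB zeroB).star (single zeroB zeroB))) := by
  intro h
  have hA := ne_zeroB hAB
  obtain ⟨p, hp, hpi, hps⟩ := exists_star_inst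
    (f := (double.{u} zeroB A A B).times (single zeroB zeroB))
    (g := (double zeroB A A B).times (single zeroB zeroB)) (q := pairing zeroB zeroB)
    (by simp [inst_times]) (recursive_zeroB.pair recursive_zeroB)
    (id.pair (id.fst.fst.pair (const computable_zeroB)))
    (by simp +contextual [inst_times, sol_times, hA.symm])
  obtain ⟨q, hq, hqi, h⟩ := h.exists_recursive hp hpi
  obtain ⟨hq1, hq2⟩ := inst_times.1 hqi
  have hq1 : fstB q = zeroB := by
    rcases inst_double.1 hq1 with h | h
    · exact h
    · exact absurd (h ▸ (hq B).fst) hAB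
  obtain ⟨w, hw, hi, hws⟩ := hq2.star_step (X := A) (r := zeroB) (fun X => (hq X).snd)
    (by simpa using (inst_star.1 hq2).1) (recursive_zeroB A)
  obtain ⟨k, hk, hs⟩ := h A (pairing A (pairing (fstB w) zeroB))
    ((TuringLE.refl A).pair (hw.fst.pair (recursive_zeroB A)))
    (sol_times.2 ⟨by simp [hq1], by simpa using hws zeroB (by simpa using hi)⟩)
  obtain ⟨s, hs, -, hk'⟩ := hps k hs
  simp [sol_times, hA.symm] at hs hk'
  simp [hs, hA] at hk'
  exact hBA (hk'.1 ▸ hk.snd.fst)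

/-- The first `⊓` of the target may answer `A`, but the next question must contain `B`. -/
lemma not_inf_star_reduces (hBA : ¬ TuringLE B A) :
    ¬ ((single.{u} zeroB A).inf ((single B zeroB).star (single zeroB B))).Reduces
      (((single zeroB A).inf (single B zeroB)).star
        ((single zeroB A).inf (single zeroB B))) := by
  intro h
  obtain ⟨p, hp, hpi, -⟩ := exists_star_inst (f := single.{u} B zeroB)
    (g := single zeroB B) (q := zeroB) (by simp) recursive_zeroB (id.pair id.fst) (by simp)
  obtain ⟨q, hq, hqi, h⟩ := h.exists_recursive (recursive_zeroB.pair hp)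
    (inst_inf.2 (by simpa using hpi))
  have hq' := inst_inf.1 (inst_star.1 hqi).1
  obtain ⟨w, hw, hi, -⟩ := hqi.star_step (r := consB 0 A) (X := A) hq
    (sol_inf.2 ⟨hq'.1, hq'.2, by simpa using hq'.1⟩) ((TuringLE.refl A).cons 0)
  simp only [inst_inf, inst_single] at hi
  exact hBA (hi.2 ▸ hw.snd.snd)

/-- Each round of the source has a forced answer, `A` and then `B`. The target may answer `double`
alone, giving just one of them. -/
lemma not_inf_star_inf_reduces (hAB : ¬ TuringLE A B) (hBA : ¬ TuringLE B A) :
    ¬ (((double.{u} zeroB A oneB B).inf (single zeroB B)).star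
        ((double zeroB A oneB B).inf (single zeroB A))).Reduces
      ((double zeroB A oneB B).inf ((single zeroB B).star (single zeroB A))) := by
  intro h
  obtain ⟨p, hp, hpi, hps⟩ := exists_star_inst
    (f := (double.{u} zeroB A oneB B).inf (single zeroB B))
    (g := (double zeroB A oneB B).inf (single zeroB A)) (q := pairing zeroB zeroB)
    (by simp [inst_inf]) (recursive_zeroB.pair recursive_zeroB)
    (id.pair ((const computable_oneB).pair (const computable_zeroB)))
    (by simp [inst_inf])
  have key : ∀ k, (((double.{u} zeroB A oneB B).inf (single zeroB B)).star
      ((double zeroB A oneB B).inf (single zeroB A))).sol p k →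
      tailB (fstB (fstB k)) = A ∧ tailB (sndB k) = B := by
    intro k hk
    obtain ⟨s, h1, h2, h3⟩ := hps k hk
    simp [sol_inf] at h1 h2 h3
    rw [h2]
    exact ⟨by rcases h1 with h | h <;> exact h.2, by rcases h3 with h | h <;> exact h.2⟩
  obtain ⟨q, hq, hqi, h⟩ := h.exists_recursive hp hpi
  have hqi' := inst_inf.1 hqi
  rcases inst_double.1 hqi'.1 with hz | hz
  · obtain ⟨k, hk, hs⟩ := h A (consB 0 A) ((TuringLE.refl A).cons 0)
      (sol_inf.2 ⟨hqi'.1, hqi'.2, by simp [hz]⟩)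
    exact hBA ((key k hs).2 ▸ hk.snd.tail)
  · obtain ⟨k, hk, hs⟩ := h B (consB 0 B) ((TuringLE.refl B).cons 0)
      (sol_inf.2 ⟨hqi'.1, hqi'.2, by simp [hz]⟩)
    exact hAB ((key k hs).1 ▸ hk.fst.fst.tail)

/-- The last question is the pair of `A` and `B`; the first factor of the target has only `A` to
form it. -/
lemma not_star_times_reduces (hBA : ¬ TuringLE B A) :
    ¬ ((single.{u} (pairing A B) zeroB).star ((single zeroB A).times (single zeroB B))).Reduces
      (((single (pairing A B) zeroB).star (single zeroB A)).times
        ((single (pairing A B) zeroB).star (single zeroB B))) := by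
  intro h
  obtain ⟨p, hp, hpi, -⟩ := exists_star_inst (f := single.{u} (pairing A B) zeroB)
    (g := (single zeroB A).times (single zeroB B)) (q := pairing zeroB zeroB)
    (by simp [inst_times]) (recursive_zeroB.pair recursive_zeroB)
    (id.pair (id.fst.fst.pair id.fst.snd)) (by simp +contextual [sol_times])
  obtain ⟨q, hq, hqi, -⟩ := h.exists_recursive hp hpi
  have hqi := (inst_times.1 hqi).1
  obtain ⟨w, hw, hi, -⟩ := hqi.star_step (r := A) (fun X => (hq X).fst)
    (by simpa using (inst_star.1 hqi).1) (TuringLE.refl A)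
  rw [inst_single] at hi
  exact hBA ((TuringLE.right A B).trans (hi ▸ hw.snd))

/-- The source uses `double` at both of its instances, the target only once. -/
lemma not_star_times_star_reduces (hAB : ¬ TuringLE A B) (hBA : ¬ TuringLE B A) :
    ¬ (((double.{u} zeroB A oneB B).star (single zeroB zeroB)).times
        ((double zeroB A oneB B).star (single zeroB zeroB))).Reduces
      ((double zeroB A oneB B).star ((single zeroB zeroB).times (single zeroB zeroB))) := by
  intro h
  obtain ⟨p, hp, hpi, hps⟩ := exists_star_inst (f := double.{u} zeroB A oneB B)
    (g := single zeroB zeroB) (q := zeroB) (by simp) recursive_zeroB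
    (id.pair (const computable_zeroB)) (by simp)
  obtain ⟨p', hp', hpi', hps'⟩ := exists_star_inst (f := double.{u} zeroB A oneB B)
    (g := single zeroB zeroB) (q := zeroB) (by simp) recursive_zeroB
    (id.pair (const computable_oneB)) (by simp)
  obtain ⟨q, hq, hqi, h⟩ := h.exists_recursive (hp.pair hp')
    (inst_times.2 (by simpa using ⟨hpi, hpi'⟩))
  have key : ∀ k, (((double.{u} zeroB A oneB B).star (single zeroB zeroB)).times
      ((double zeroB A oneB B).star (single zeroB zeroB))).sol (pairing p p') k →
      sndB (fstB k) = A ∧ sndB (sndB k) = B := by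
    intro k hk
    simp only [sol_times, fstB_pairing, sndB_pairing] at hk
    obtain ⟨s, -, -, h1⟩ := hps _ hk.1
    obtain ⟨s', -, -, h2⟩ := hps' _ hk.2
    simp at h1 h2
    exact ⟨h1, h2⟩
  obtain ⟨w, hw, hi, hws⟩ := hqi.star_step (r := pairing zeroB zeroB) (X := zeroB) hq
    (by simpa [inst_times, sol_times] using (inst_star.1 hqi).1)
    (recursive_zeroB.pair recursive_zeroB _)
  have hw := recursive_of_turingLE hw recursive_zeroB
  rcases inst_double.1 hi with hz | hz
  · obtain ⟨k, hk, hs⟩ := h A _ ((hw A).fst.pair (TuringLE.refl A)) (hws A (by simp [hz]))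
    exact hBA ((key k hs).2 ▸ hk.snd.snd)
  · obtain ⟨k, hk, hs⟩ := h B _ ((hw B).fst.pair (TuringLE.refl B)) (hws B (by simp [hz]))
    exact hAB ((key k hs).1 ▸ hk.fst.snd)

/-- Any solution of the inner implication reveals `A`, the only instance of its premise, and so
allows the question `A`. In the target this question must be formed from the recursive answer
`zeroB`. -/
lemma not_impl_star_impl_reduces_impl_star (hAB : ¬ TuringLE A B) :
    ¬ (((single.{u} A zeroB).impl (single A zeroB)).star
        ((single A zeroB).impl (single zeroB zeroB))).Reduces
      ((single A zeroB).impl ((single A zeroB).star (single zeroB zeroB))) := by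
  intro h
  obtain ⟨p, hp, hpi, -⟩ := exists_star_inst (f := (single.{u} A zeroB).impl (single A zeroB))
    (g := (single A zeroB).impl (single zeroB zeroB)) (q := zeroB) (by simp [inst_impl])
    recursive_zeroB (id.pair id.fst.snd) (by simp +contextual [inst_impl, sol_impl])
  obtain ⟨q, hq, hqi, -⟩ := h.exists_recursive hp hpi
  have hqi := (inst_impl.1 hqi).1
  obtain ⟨w, hw, hi, -⟩ := hqi.star_step (r := zeroB) (X := B) hq
    (by simpa using (inst_star.1 hqi).1) (recursive_zeroB B)
  rw [inst_single] at hi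
  exact hAB (hi ▸ hw.snd)

/-- In the source the answer `A` of the inner problem can be used as the next instance. In the
target the inner implication has a recursive solution, which does not help to find the question `A`.
-/
lemma not_impl_star_reduces (hAB : ¬ TuringLE A B) :
    ¬ ((single.{u} zeroB A).impl ((single A zeroB).star (single zeroB A))).Reduces
      (((single zeroB A).impl (single A zeroB)).star
        ((single zeroB A).impl (single zeroB A))) := by
  intro h
  obtain ⟨p, hp, hpi, -⟩ := exists_star_inst (f := single.{u} A zeroB)
    (g := single zeroB A) (q := zeroB) (by simp) recursive_zeroB (id.pair id.fst) (by simp)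
  obtain ⟨q, hq, hqi, -⟩ := h.exists_recursive hp (inst_impl.2 ⟨hpi, by simp⟩)
  obtain ⟨r, hr, hrs⟩ := exists_impl_sol (f := single.{u} zeroB A) (g := single zeroB A)
    (p := zeroB) (q := zeroB) (by simp) (by simp) recursive_zeroB id.fst (by simp)
  have hz := inst_single.1 (inst_impl.1 (inst_star.1 hqi).1).1
  obtain ⟨w, hw, hi, -⟩ := hqi.star_step (X := B) hq (hz ▸ hrs) (hr B)
  have hi := inst_single.1 (inst_impl.1 hi).1
  exact hAB (hi ▸ hw.snd)

/-- In the source a single choice is fed to both factors, and exactly one of them answers `E`. In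
the target the two choices are independent: `A` on the left and `B` on the right force the answers
`zeroB`, so all is computable from `A` and `B`. -/
lemma not_times_star_reduces (hAB : ¬ TuringLE A B) (hBA : ¬ TuringLE B A)
    (hE : ¬ TuringLE E (pairing A B)) :
    ¬ (((double.{u} A zeroB B E).times (double A E B zeroB)).star
        (choice zeroB (consB 0 A) (consB 1 B))).Reduces
      (((double A zeroB B E).star (choice zeroB (consB 0 A) (consB 1 B))).times
        ((double A E B zeroB).star (choice zeroB (consB 0 A) (consB 1 B)))) := by
  intro h
  have hne : A ≠ B := by
    rintro rfl
    exact hAB (TuringLE.refl A)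
  obtain ⟨p, hp, hpi, hps⟩ := exists_star_inst
    (f := (double.{u} A zeroB B E).times (double A E B zeroB))
    (g := choice zeroB (consB 0 A) (consB 1 B)) (q := zeroB) (by simp) recursive_zeroB
    (id.pair (id.fst.tail.pair id.fst.tail)) (by
      intro s hs
      rcases (sol_choice.1 hs).2 with h | h <;> simp [inst_times, h])
  obtain ⟨q, hq, hqi, h⟩ := h.exists_recursive hp hpi
  obtain ⟨h1, h2⟩ := inst_times.1 hqi
  obtain ⟨w, hw, hi, hws⟩ := h1.star_step (r := consB 0 A) (X := A) (fun X => (hq X).fst)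
    (by simpa using (inst_star.1 h1).1) ((TuringLE.refl A).cons 0)
  obtain ⟨w', hw', hi', hws'⟩ := h2.star_step (r := consB 1 B) (X := B) (fun X => (hq X).snd)
    (by simpa using (inst_star.1 h2).1) ((TuringLE.refl B).cons 1)
  have hi : sndB w = A := by
    rcases inst_double.1 hi with h | h
    · exact h
    · exact absurd (h ▸ hw.snd) hBA
  have hi' : sndB w' = B := by
    rcases inst_double.1 hi' with h | h
    · exact absurd (h ▸ hw'.snd) hAB
    · exact h
  obtain ⟨k, hk, hs⟩ := h (pairing A B) (pairing (pairing (fstB w) zeroB) (pairing (fstB w') zeroB))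
    (((hw.trans (TuringLE.left A B)).fst.pair (recursive_zeroB _)).pair
      ((hw'.trans (TuringLE.right A B)).fst.pair (recursive_zeroB _)))
    (sol_times.2 ⟨by simpa using hws zeroB (by simp [hi]), by simpa using hws' zeroB (by simp [hi'])⟩)
  obtain ⟨s, hs, -, h3⟩ := hps _ hs
  rcases (sol_choice.1 hs).2 with h | h
  · simp [sol_times, h, hne] at h3
    exact hE (h3.2 ▸ hk.snd.snd)
  · simp [sol_times, h, hne.symm] at h3
    exact hE (h3.1 ▸ hk.snd.fst)

/-- The source uses `double` at both of its instances and passes the answers on; the target uses it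
only once. -/
lemma not_star_times_star_reduces_times_star (hAB : ¬ TuringLE A B) (hBA : ¬ TuringLE B A) :
    ¬ (((single.{u} zeroB zeroB).star (double zeroB A oneB B)).times
        ((single zeroB zeroB).star (double zeroB A oneB B))).Reduces
      (((single zeroB zeroB).times (single zeroB zeroB)).star (double zeroB A oneB B)) := by
  intro h
  obtain ⟨p, hp, hpi, hps⟩ := exists_star_inst (f := single.{u} zeroB zeroB)
    (g := double zeroB A oneB B) (q := zeroB) (by simp) recursive_zeroB
    (id.fst.pair (const computable_zeroB)) (by simp)
  obtain ⟨p', hp', hpi', hps'⟩ := exists_star_inst (f := single.{u} zeroB zeroB)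
    (g := double zeroB A oneB B) (q := oneB) (by simp) recursive_oneB
    (id.fst.pair (const computable_zeroB)) (by simp)
  obtain ⟨q, hq, hqi, h⟩ := h.exists_recursive (hp.pair hp')
    (inst_times.2 (by simpa using ⟨hpi, hpi'⟩))
  have key : ∀ k, (((single.{u} zeroB zeroB).star (double zeroB A oneB B)).times
        ((single zeroB zeroB).star (double zeroB A oneB B))).sol (pairing p p') k →
      fstB (fstB k) = A ∧ fstB (sndB k) = B := by
    intro k hk
    simp only [sol_times, fstB_pairing, sndB_pairing] at hk
    obtain ⟨s, h1, h2, -⟩ := hps _ hk.1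
    obtain ⟨s', h3, h4, -⟩ := hps' _ hk.2
    simp at h1 h2 h3 h4
    exact ⟨h2.trans h1, h4.trans h3⟩
  rcases inst_double.1 (inst_star.1 hqi).1 with hz | hz
  · obtain ⟨w, hw, hi, hws⟩ := hqi.star_step (r := A) hq (by simp [hz]) (TuringLE.refl A)
    obtain ⟨k, hk, hs⟩ := h A _ (hw.fst.pair (recursive_zeroB.pair recursive_zeroB A))
      (hws _ (by simpa [sol_times, inst_times] using hi))
    exact hBA ((key k hs).2 ▸ hk.snd.fst)
  · obtain ⟨w, hw, hi, hws⟩ := hqi.star_step (r := B) hq (by simp [hz]) (TuringLE.refl B)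
    obtain ⟨k, hk, hs⟩ := h B _ (hw.fst.pair (recursive_zeroB.pair recursive_zeroB B))
      (hws _ (by simpa [sol_times, inst_times] using hi))
    exact hAB ((key k hs).1 ▸ hk.fst.fst)

end Problem

/-! ### Properness of the test degrees, and the proposition -/

namespace WProblem

open Problem

variable {f g : Problem.{u}}

lemma proper_fn (h : ∃ p, f.inst p) : (fn f).Proper :=
  ⟨fun h' => not_exists.2 (fn_equiv_zero.1 h') h, not_fn_equiv_infty f⟩

lemma proper_single (x A : Baire) : (fn (single.{u} x A)).Proper := proper_fn ⟨x, by simp⟩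

lemma proper_double (x A y B : Baire) : (fn (double.{u} x A y B)).Proper :=
  proper_fn ⟨x, by simp⟩

lemma proper_choice (x A B : Baire) : (fn (choice.{u} x A B)).Proper := proper_fn ⟨x, by simp⟩

lemma impl_fn_of_inst {p : Baire} (h : g.inst p) : (fn g).impl (fn f) = fn (g.impl f) :=
  impl_fn (.inl ⟨p, h⟩)

end WProblem

end Weihrauch

end

theorem proposition39 :
    -- the reductions and equalities, for all degrees
    (∀ a b c : WProblem.{u},
      (a ×w (b ⊔w c) ≡w (a ×w b) ⊔w (a ×w c)) ∧
      (a ⋆w (b ⊔w c) ≡w (a ⋆w b) ⊔w (a ⋆w c)) ∧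
      ((b ⋆w a) ⊔w (c ⋆w a) ≤w (b ⊔w c) ⋆w a) ∧
      ((b ⊓w c) ⋆w a ≤w (b ⋆w a) ⊓w (c ⋆w a)) ∧
      (a ×w (b ⊓w c) ≤w (a ×w b) ⊓w (a ×w c)) ∧
      (a ⋆w (b ⊓w c) ≡w (a ⋆w b) ⊓w (a ⋆w c)) ∧
      (a ⊔w (b ×w c) ≤w (a ⊔w b) ×w (a ⊔w c)) ∧
      (a ⊔w (b ⋆w c) ≤w (a ⊔w b) ⋆w (a ⊔w c)) ∧
      ((a ≡w ∞w ∨ (b ≡w ∞w ↔ c ≡w ∞w)) →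
        a ⊓w (b ×w c) ≤w (a ⊓w b) ×w (a ⊓w c)) ∧
      ((a ⇒w (b ⊔w c)) ≡w (a ⇒w b) ⊔w (a ⇒w c)) ∧
      ((¬ a ≡w zero_w ∨ (b ≡w zero_w ↔ c ≡w zero_w) ∨ b ≡w ∞w ∨ c ≡w ∞w) →
        (a ⇒w b) ×w (a ⇒w c) ≤w (a ⇒w (b ×w c))) ∧
      (((a ×w b) ⇒w c) ≤w (a ⇒w c) ×w (b ⇒w c)) ∧
      ((a ⇒w (b ⊓w c)) ≤w (a ⇒w b) ⊓w (a ⇒w c)) ∧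
      (((a ⋆w b) ⇒w c) ≤w (a ⇒w c) ⋆w (b ⇒w c)) ∧
      (a ×w (b ⋆w c) ≤w (a ×w b) ⋆w (a ×w c))) ∧
    -- none of the one-sided reductions is an equality in general
    (∃ a b c : WProblem.{u}, a.Proper ∧ b.Proper ∧ c.Proper ∧
      ¬ ((b ⊔w c) ⋆w a ≤w (b ⋆w a) ⊔w (c ⋆w a))) ∧
    (∃ a b c : WProblem.{u}, a.Proper ∧ b.Proper ∧ c.Proper ∧
      ¬ ((b ⋆w a) ⊓w (c ⋆w a) ≤w (b ⊓w c) ⋆w a)) ∧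
    (∃ a b c : WProblem.{u}, a.Proper ∧ b.Proper ∧ c.Proper ∧
      ¬ ((a ×w b) ⊓w (a ×w c) ≤w a ×w (b ⊓w c))) ∧
    (∃ a b c : WProblem.{u}, a.Proper ∧ b.Proper ∧ c.Proper ∧
      ¬ ((a ⊔w b) ×w (a ⊔w c) ≤w a ⊔w (b ×w c))) ∧
    (∃ a b c : WProblem.{u}, a.Proper ∧ b.Proper ∧ c.Proper ∧
      ¬ ((a ⊔w b) ⋆w (a ⊔w c) ≤w a ⊔w (b ⋆w c))) ∧
    (∃ a b c : WProblem.{u}, a.Proper ∧ b.Proper ∧ c.Proper ∧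
      ¬ ((a ⊓w b) ×w (a ⊓w c) ≤w a ⊓w (b ×w c))) ∧
    (∃ a b c : WProblem.{u}, a.Proper ∧ b.Proper ∧ c.Proper ∧
      ¬ ((a ⇒w (b ×w c)) ≤w (a ⇒w b) ×w (a ⇒w c))) ∧
    (∃ a b c : WProblem.{u}, a.Proper ∧ b.Proper ∧ c.Proper ∧
      ¬ ((a ⇒w c) ×w (b ⇒w c) ≤w ((a ×w b) ⇒w c))) ∧
    (∃ a b c : WProblem.{u}, a.Proper ∧ b.Proper ∧ c.Proper ∧
      ¬ ((a ⇒w b) ⊓w (a ⇒w c) ≤w (a ⇒w (b ⊓w c)))) ∧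
    (∃ a b c : WProblem.{u}, a.Proper ∧ b.Proper ∧ c.Proper ∧
      ¬ ((a ⇒w c) ⋆w (b ⇒w c) ≤w ((a ⋆w b) ⇒w c))) ∧
    (∃ a b c : WProblem.{u}, a.Proper ∧ b.Proper ∧ c.Proper ∧
      ¬ ((a ×w b) ⋆w (a ×w c) ≤w a ×w (b ⋆w c))) ∧
    -- the pairs for which neither reduction holds in general
    (∃ a b c : WProblem.{u}, a.Proper ∧ b.Proper ∧ c.Proper ∧
      ¬ (a ⊓w (b ⋆w c) ≤w (a ⊓w b) ⋆w (a ⊓w c))) ∧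
    (∃ a b c : WProblem.{u}, a.Proper ∧ b.Proper ∧ c.Proper ∧
      ¬ ((a ⊓w b) ⋆w (a ⊓w c) ≤w a ⊓w (b ⋆w c))) ∧
    (∃ a b c : WProblem.{u}, a.Proper ∧ b.Proper ∧ c.Proper ∧
      ¬ (a ⋆w (b ×w c) ≤w (a ⋆w b) ×w (a ⋆w c))) ∧
    (∃ a b c : WProblem.{u}, a.Proper ∧ b.Proper ∧ c.Proper ∧
      ¬ ((a ⋆w b) ×w (a ⋆w c) ≤w a ⋆w (b ×w c))) ∧
    (∃ a b c : WProblem.{u}, a.Proper ∧ b.Proper ∧ c.Proper ∧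
      ¬ ((a ⇒w b) ⋆w (a ⇒w c) ≤w (a ⇒w (b ⋆w c)))) ∧
    (∃ a b c : WProblem.{u}, a.Proper ∧ b.Proper ∧ c.Proper ∧
      ¬ ((a ⇒w (b ⋆w c)) ≤w (a ⇒w b) ⋆w (a ⇒w c))) ∧
    (∃ a b c : WProblem.{u}, a.Proper ∧ b.Proper ∧ c.Proper ∧
      ¬ ((a ×w b) ⋆w c ≤w (a ⋆w c) ×w (b ⋆w c))) ∧
    (∃ a b c : WProblem.{u}, a.Proper ∧ b.Proper ∧ c.Proper ∧
      ¬ ((a ⋆w c) ×w (b ⋆w c) ≤w (a ×w b) ⋆w c)) := by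
  obtain ⟨A, B, hAB, hBA⟩ := exists_incomparable
  obtain ⟨E, hE⟩ := exists_not_turingLE (pairing A B)
  open WProblem Problem in
  refine ⟨fun a b c => ⟨times_sup_equiv a b c, star_sup_equiv a b c, star_sup_star_le a b c,
    inf_star_le a b c, times_inf_le a b c, star_inf_equiv a b c, sup_times_le a b c,
    sup_star_le a b c, inf_times_le a b c, impl_sup_equiv a b c, impl_times_le a b c,
    times_impl_le a b c, impl_inf_le a b c, star_impl_le a b c, times_star_le a b c⟩,
    ⟨_, _, _, proper_choice _ _ _, proper_single _ _, proper_single _ _,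
      not_sup_star_reduces hAB hBA⟩,
    ⟨_, _, _, proper_double _ _ _ _, proper_single _ _, proper_single _ _,
      not_star_inf_star_reduces hAB hBA⟩,
    ⟨_, _, _, proper_double _ _ _ _, proper_single _ _, proper_single _ _,
      not_times_inf_times_reduces hAB hBA⟩,
    ⟨_, _, _, proper_single _ _, proper_single _ _, proper_single _ _,
      not_sup_times_sup_reduces hAB hBA⟩,
    ⟨_, _, _, proper_single _ _, proper_single _ _, proper_single _ _,
      not_sup_star_sup_reduces hAB hBA⟩,
    ⟨_, _, _, proper_double _ _ _ _, proper_single _ _, proper_single _ _,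
      not_inf_times_inf_reduces hAB hBA⟩,
    ⟨_, _, _, proper_double zeroB A oneB B, proper_single zeroB A, proper_single zeroB B, ?_⟩,
    ⟨_, _, _, proper_single zeroB A, proper_single zeroB B, proper_single zeroB (pairing A B), ?_⟩,
    ⟨_, _, _, proper_choice zeroB (consB 0 A) (consB 1 B), proper_single zeroB A,
      proper_single zeroB B, ?_⟩,
    ⟨_, _, _, proper_single zeroB A, proper_single zeroB B, proper_single zeroB (pairing A B), ?_⟩,
    ⟨_, _, _, proper_double _ _ _ _, proper_single _ _, proper_single _ _,
      not_times_star_times_reduces hAB hBA⟩,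
    ⟨_, _, _, proper_single _ _, proper_single _ _, proper_single _ _,
      not_inf_star_reduces hBA⟩,
    ⟨_, _, _, proper_double _ _ _ _, proper_single _ _, proper_single _ _,
      not_inf_star_inf_reduces hAB hBA⟩,
    ⟨_, _, _, proper_single _ _, proper_single _ _, proper_single _ _,
      not_star_times_reduces hBA⟩,
    ⟨_, _, _, proper_double _ _ _ _, proper_single _ _, proper_single _ _,
      not_star_times_star_reduces hAB hBA⟩,
    ⟨_, _, _, proper_single A zeroB, proper_single A zeroB, proper_single zeroB zeroB, ?_⟩,
    ⟨_, _, _, proper_single zeroB A, proper_single A zeroB, proper_single zeroB A, ?_⟩,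
    ⟨_, _, _, proper_double _ _ _ _, proper_double _ _ _ _, proper_choice _ _ _,
      not_times_star_reduces hAB hBA hE⟩,
    ⟨_, _, _, proper_single _ _, proper_single _ _, proper_double _ _ _ _,
      not_star_times_star_reduces_times_star hAB hBA⟩⟩
  -- Implication of degrees is defined by cases, so each occurrence is unfolded by exhibiting an
  -- instance of its premise.
  · rw [times_fn, impl_fn_of_inst (p := zeroB) (by simp), impl_fn_of_inst (p := zeroB) (by simp),
      impl_fn_of_inst (p := zeroB) (by simp), times_fn]
    exact not_impl_times_reduces hAB hBA
  · rw [times_fn, impl_fn_of_inst (p := zeroB) (by simp), impl_fn_of_inst (p := zeroB) (by simp),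
      impl_fn_of_inst (p := pairing zeroB zeroB) (by simp [inst_times]), times_fn]
    exact not_impl_times_impl_reduces hBA
  · rw [inf_fn, impl_fn_of_inst (p := zeroB) (by simp), impl_fn_of_inst (p := zeroB) (by simp),
      impl_fn_of_inst (p := zeroB) (by simp), inf_fn]
    exact not_impl_inf_impl_reduces hAB hBA
  · obtain ⟨p, hp⟩ := exists_inst_star (f := single zeroB A) (g := single zeroB B)
      ⟨zeroB, by simp⟩ ⟨zeroB, by simp⟩
    rw [star_fn, impl_fn_of_inst (p := zeroB) (by simp), impl_fn_of_inst (p := zeroB) (by simp),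
      impl_fn_of_inst hp, star_fn]
    exact not_impl_star_impl_reduces hBA
  · rw [star_fn, impl_fn_of_inst (p := A) (by simp), impl_fn_of_inst (p := A) (by simp),
      impl_fn_of_inst (p := A) (by simp), star_fn]
    exact not_impl_star_impl_reduces_impl_star hAB
  · rw [star_fn, impl_fn_of_inst (p := zeroB) (by simp), impl_fn_of_inst (p := zeroB) (by simp),
      impl_fn_of_inst (p := zeroB) (by simp), star_fn]
    exact not_impl_star_reduces hAB
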